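/- Let $T>0$, $S_1=\{-1,1\}$, and for $i=1,\dots,n$, $x\in\mathbb R^n$ let $F_i(x)\subset\mathbb R$ be a nonempty convex compact set whose support function $c(F_i(x),\psi)=\sup_{a\in F_i(x)}a\psi$ satisfies, for all $\psi\in S_1$, $$c(F_i(x),\psi)=\sum_{j=1}^{r}\max_{1\le q\le m(j)} f_{i,j_q}(x)\psi+\sum_{j=1}^{s}\min_{1\le p\le k(j)} g_{i,j_p}(x,\psi),$$ where $m(j),k(j)\ge 1$ and the functions $f_{i,j_q}$ and $g_{i,j_p}(\cdot,\psi)$, $\psi\in S_1$, are continuously differentiable on $\mathbb R^n$. For $x,z\in\mathbb R^n$ put $\ell_i(\psi,x,z)=z_i\psi-c(F_i(x),\psi)$, $h_i(x,z)=\max_{\psi\in S_1}\max\{0,\ell_i(\psi,x,z)\}$, $h=(h_1,\dots,h_n)$ and $h^2=\|h\|^2$. Fix $\psi_i^0\in S_1$; let $\psi_i^*=\psi_i^*(x,z)$ be the maximizer of $\ell_i(\cdot,x,z)$ on $S_1$ if $h_i(x,z)>0$ (it is unique) and $\psi_i^*=\psi_i^0$ if $h_i(x,z)=0$. A function under a maximum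 (minimum) is called active at a point if it attains this maximum (minimum) there. Define the following sets in $\mathbb R^n\times\mathbb R^n$ (at $(x,z)$, with sums and multiples of sets taken pointwise, and $e_i$ the standard basis of $\mathbb R^n$): $$\tfrac12\overline\partial h^2=\sum_{i=1}^n h_i\Big(\{(0,\psi_i^*e_i)\}+\sum_{j=1}^{r}\mathrm{co}\{(-\psi_i^*\nabla f_{i,j_q}(x),0)\;:\; f_{i,j_q}(\cdot)\psi_i^*\text{ active at }x\text{ in the }j\text{-th maximum}\}\Big),$$ $$\tfrac12\underline\partial h^2=\sum_{i=1}^n h_i\sum_{j=1}^{s}\mathrm{co}\{(-\nabla_x g_{i,j_p}(x,\psi_i^*),0)\;:\; g_{i,j_p}(\cdot,\psi_i^*)\text{ active at }x\text{ in the }j\text{-th minimum}\}.$$ A pair $[A,B]$ of convex compact sets in a Euclidean space is a quasidifferential of a real function at a point if its one-sided directional derivative there exists in every direction $d$ and equals $\max_{v\in A}\langle v,d\rangle+\min_{w\in B}\langle w,d\rangle$. For a functional on a (semi)normed space the definition is the same, with $A,B$ convex weakly$^*$ compact subsets of the dual space and $v(g),w(g)$ in place of $\langle v,d\rangle,\langle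 w,d\rangle$. Let $C_n[0,T]$ be the space of continuous functions $[0,T]\to\mathbb R^n$, and $P_n[0,T]$ the space of bounded functions $[0,T]\to\mathbb R^n$ that are continuous off a finite set, and equip $C_n[0,T]\times P_n[0,T]$ with the (semi)norm of $L^2_n[0,T]\times L^2_n[0,T]$. Then: 1. At every $(x,z)\in\mathbb R^n\times\mathbb R^n$ the pair $[\underline\partial h^2(x,z),\overline\partial h^2(x,z)]$ is a quasidifferential of $h^2$. 2. The functional $\varphi(x,z)=\tfrac12\int_0^T\|h(x(t),z(t))\|^2\,dt$ is well defined (the integrand is integrable) on $C_n[0,T]\times P_n[0,T]$. 3. Let $(x,z)\in C_n[0,T]\times P_n[0,T]$ and suppose that $[0,T]$ can be divided into finitely many intervals such that on each of them, for all $i$, $j$ and all $\psi_i\in S_1$, one (or several) fixed functions of the family $\{f_{i,j_1}(x)\psi_i,\dots,f_{i,j_{m(j)}}(x)\psi_i\}$, $j\le r$, and one (or several) fixed functions of the family $\{g_{i,j_1}(x,\psi_i),\dots,g_{i,j_{k(j)}}(x,\psi_i)\}$, $j\le s$, are active at $x(t)$ for all $t$ of the interval with $\psi_i^*(x(t),z(t))=\psi_i$.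 Then $\varphi$ is quasidifferentiable at $(x,z)$, that is, for every $g=(g_1,g_2)\in C_n[0,T]\times P_n[0,T]$ $$\lim_{\alpha\downarrow0}\frac1\alpha\big(\varphi(x+\alpha g_1,z+\alpha g_2)-\varphi(x,z)\big)=\max_{v\in\underline\partial\varphi(x,z)}v(g)+\min_{w\in\overline\partial\varphi(x,z)}w(g),$$ with the following convex weakly$^*$ compact sets. $\underline\partial\varphi(x,z)$ consists of the continuous linear functionals $v$ on $C_n[0,T]\times P_n[0,T]$ of the form $v(g)=\int_0^T\langle v_1(t),g_1(t)\rangle dt+\int_0^T\langle v_2(t),g_2(t)\rangle dt$ with $v_1,v_2\in L^\infty_n[0,T]$ and $(v_1(t),v_2(t))\in\tfrac12\underline\partial h^2(x(t),z(t))$ for all $t\in[0,T]$. $\overline\partial\varphi(x,z)$ is the set of functionals of the same form with $(v_1(t),v_2(t))\in\tfrac12\overline\partial h^2(x(t),z(t))$ for all $t\in[0,T]$. -/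

import Mathlib

open MeasureTheory Filter Topology Set
open scoped Pointwise ENNReal

noncomputable section

namespace QuasiInclusion

/-- The Euclidean space `ℝⁿ`. -/
abbrev E (n : ℕ) : Type := EuclideanSpace ℝ (Fin n)

/-- `ℝⁿ × ℝⁿ` with its standard (Euclidean) norm and scalar product. -/
abbrev E2 (n : ℕ) : Type := WithLp 2 (E n × E n)

/-- The unit sphere `S₁ = {-1, 1}` of `ℝ`. -/
def S1 : Set ℝ := Metric.sphere 0 1

lemma S1_eq : S1 = {1, -1} := by
  ext ψ
  simp only [S1, mem_sphere_iff_norm, sub_zero, Real.norm_eq_abs, mem_insert_iff,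
    mem_singleton_iff]
  exact abs_eq zero_le_one

/-- The support function `c(A, ψ) = sup_{a ∈ A} a ψ` of a set `A ⊆ ℝ`. -/
def supportFn (A : Set ℝ) (ψ : ℝ) : ℝ := sSup ((fun a => a * ψ) '' A)

/-! ### Quasidifferentials -/

/-- `[A, B]` is a quasidifferential of `f` at the point `p` of a Euclidean space: `A` and `B` are
convex and compact, and the derivative of `f` at `p` in every direction `d` exists and is
`max_{v ∈ A} ⟨v, d⟩ + min_{w ∈ B} ⟨w, d⟩`. -/
def IsQuasidifferentialAt {H : Type*} [NormedAddCommGroup H] [InnerProductSpace ℝ H]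
    (f : H → ℝ) (p : H) (A B : Set H) : Prop :=
  Convex ℝ A ∧ IsCompact A ∧ Convex ℝ B ∧ IsCompact B ∧
    ∀ d : H, ∃ a b : ℝ,
      IsGreatest ((fun v => inner ℝ v d) '' A) a ∧
      IsLeast ((fun w => inner ℝ w d) '' B) b ∧
      Tendsto (fun α : ℝ => α⁻¹ * (f (p + α • d) - f p)) (𝓝[>] 0) (𝓝 (a + b))

/-- `[A, B]` is a quasidifferential of the functional `Φ` at the point `p` of the space `V`:
`A` and `B` are convex and weakly* compact subsets of the dual of `V`, and the derivative of `Φ`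
at `p` in every direction `g` exists and is `max_{v ∈ A} v(g) + min_{w ∈ B} w(g)`. -/
def IsFunctionalQuasidifferentialAt {V : Type*} [SeminormedAddCommGroup V] [NormedSpace ℝ V]
    (Φ : V → ℝ) (p : V) (A B : Set (WeakDual ℝ V)) : Prop :=
  Convex ℝ A ∧ IsCompact A ∧ Convex ℝ B ∧ IsCompact B ∧
    ∀ g : V, ∃ a b : ℝ,
      IsGreatest ((fun v : WeakDual ℝ V => v g) '' A) a ∧
      IsLeast ((fun w : WeakDual ℝ V => w g) '' B) b ∧
      Tendsto (fun α : ℝ => α⁻¹ * (Φ (p + α • g) - Φ p)) (𝓝[>] 0) (𝓝 (a + b))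

/-! ### The space `C_n[0,T] × P_n[0,T]` with the norm of `L²_n × L²_n` -/

/-- `P_n[0,T]`: the bounded functions `[0,T] → ℝⁿ` that are continuous off a finite set. -/
def PC (T : ℝ) (n : ℕ) : Submodule ℝ (Icc (0 : ℝ) T → E n) where
  carrier := {z | (∃ S : Set (Icc (0 : ℝ) T), S.Finite ∧ ∀ t ∉ S, ContinuousAt z t) ∧
    ∃ C : ℝ, ∀ t, ‖z t‖ ≤ C}
  zero_mem' := ⟨⟨∅, finite_empty, fun _ _ => continuousAt_const⟩, 0, fun _ => by simp⟩
  add_mem' := by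
    rintro u v ⟨⟨S, hS, hu⟩, C, hC⟩ ⟨⟨S', hS', hv⟩, C', hC'⟩
    refine ⟨⟨S ∪ S', hS.union hS', fun t ht => ?_⟩, C + C', fun t => ?_⟩
    · rw [mem_union, not_or] at ht
      exact (hu t ht.1).add (hv t ht.2)
    · exact (norm_add_le _ _).trans (add_le_add (hC t) (hC' t))
  smul_mem' := by
    rintro c u ⟨⟨S, hS, hu⟩, C, hC⟩
    refine ⟨⟨S, hS, fun t ht => (hu t ht).const_smul c⟩, ‖c‖ * C, fun t => ?_⟩
    rw [Pi.smul_apply, norm_smul]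
    exact mul_le_mul_of_nonneg_left (hC t) (norm_nonneg c)

/-- Lebesgue measure on `[0,T]`. -/
def leb (T : ℝ) : Measure (Icc (0 : ℝ) T) := Measure.comap Subtype.val volume

instance (T : ℝ) : IsFiniteMeasure (leb T) :=
  ⟨by
    rw [leb, comap_subtype_coe_apply measurableSet_Icc volume, image_univ, Subtype.range_coe]
    exact measure_Icc_lt_top⟩

lemma memLp_continuous {T : ℝ} {n : ℕ} (x : C(Icc (0 : ℝ) T, E n)) :
    MemLp (fun t => x t) 2 (leb T) :=
  MemLp.of_bound x.continuous.aestronglyMeasurable ‖x‖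
    (Eventually.of_forall fun t => x.norm_coe_le_norm t)

lemma memLp_piecewise {T : ℝ} {n : ℕ} (z : PC T n) :
    MemLp (fun t => z.1 t) 2 (leb T) := by
  obtain ⟨⟨S, hS, hc⟩, C, hC⟩ := z.2
  refine MemLp.of_bound ?_ C (Eventually.of_forall hC)
  have hSm : MeasurableSet S := hS.measurableSet
  have h1 : AEStronglyMeasurable z.1 ((leb T).restrict Sᶜ) :=
    ContinuousOn.aestronglyMeasurable (fun t ht => (hc t ht).continuousWithinAt) hSm.compl
  have h0 : (leb T) S = 0 := by
    rw [leb, comap_subtype_coe_apply measurableSet_Icc volume]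
    exact (hS.image _).measure_zero _
  have h2 : (leb T).restrict Sᶜ = leb T :=
    Measure.restrict_eq_self_of_ae_mem (compl_mem_ae_iff.2 h0)
  rwa [h2] at h1

/-- The underlying vector space of `C_n[0,T] × P_n[0,T]`. -/
def X (T : ℝ) (n : ℕ) : Type := C(Icc (0 : ℝ) T, E n) × PC T n

namespace X

variable {T : ℝ} {n : ℕ}

instance : AddCommGroup (X T n) := inferInstanceAs (AddCommGroup (C(Icc (0 : ℝ) T, E n) × PC T n))

instance : Module ℝ (X T n) := inferInstanceAs (Module ℝ (C(Icc (0 : ℝ) T, E n) × PC T n))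

/-- The value `x(t)` of the first component of `p = (x, z)`. -/
def x (p : X T n) (t : Icc (0 : ℝ) T) : E n := p.1 t

/-- The value `z(t)` of the second component of `p = (x, z)`. -/
def z (p : X T n) (t : Icc (0 : ℝ) T) : E n := p.2.1 t

/-- The map that sends `(x, z)` to its class in `L²_n[0,T] × L²_n[0,T]`. -/
def toL2 : X T n →ₗ[ℝ] WithLp 2 (Lp (E n) 2 (leb T) ×
    Lp (E n) 2 (leb T)) where
  toFun p := WithLp.toLp 2
    ((memLp_continuous p.1).toLp (fun t => p.1 t), (memLp_piecewise p.2).toLp (fun t => p.2.1 t))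
  map_add' _ _ := rfl
  map_smul' _ _ := rfl

/-- `C_n[0,T] × P_n[0,T]` carries the norm `(‖x‖²_{L²} + ‖z‖²_{L²})^{1/2}` (which does not see the
values of `z` at single points). -/
instance : SeminormedAddCommGroup (X T n) := SeminormedAddCommGroup.induced _ _ toL2

instance : NormedSpace ℝ (X T n) := NormedSpace.induced ℝ _ _ toL2

end X

/-! ### The differential inclusion -/

/-- The data of the differential inclusion `x'ᵢ ∈ Fᵢ(x)`, `i = 1, …, n`, together with the
functions that make up the support functions of the sets `Fᵢ(x) ⊆ ℝ`. -/
structure Inclusion (n : ℕ) where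
  /-- the sets `Fᵢ(x)` -/
  F : Fin n → E n → Set ℝ
  /-- the number of maxima -/
  r : ℕ
  /-- the number of minima -/
  s : ℕ
  /-- the number of functions in the `j`-th maximum -/
  m : Fin r → ℕ
  /-- the number of functions in the `j`-th minimum -/
  k : Fin s → ℕ
  /-- the functions `f_{i, j_q}(x)` -/
  f : Fin n → (j : Fin r) → Fin (m j) → E n → ℝ
  /-- the functions `g_{i, j_p}(x, ψ)` -/
  g : Fin n → (j : Fin s) → Fin (k j) → E n → ℝ → ℝ

namespace Inclusion

variable {n : ℕ} (D : Inclusion n)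

/-- The assumptions on the right-hand side: the `Fᵢ(x)` are nonempty, convex and compact, their
support functions at `ψ ∈ S₁` are sums of maxima and minima of finitely many functions, and these
functions are continuously differentiable in `x`. -/
structure Admissible : Prop where
  m_pos : ∀ j, 0 < D.m j
  k_pos : ∀ j, 0 < D.k j
  nonempty : ∀ i x, (D.F i x).Nonempty
  convex : ∀ i x, Convex ℝ (D.F i x)
  compact : ∀ i x, IsCompact (D.F i x)
  contDiff_f : ∀ i j q, ContDiff ℝ 1 (D.f i j q)
  contDiff_g : ∀ i j p, ∀ ψ ∈ S1, ContDiff ℝ 1 (fun x => D.g i j p x ψ)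
  support_eq : ∀ i x, ∀ ψ ∈ S1,
    supportFn (D.F i x) ψ = (∑ j, ⨆ q, D.f i j q x * ψ) + ∑ j, ⨅ p, D.g i j p x ψ

/-- `ℓᵢ(ψ, x, z) = zᵢ ψ - c(Fᵢ(x), ψ)`. -/
def ell (i : Fin n) (ψ : ℝ) (x z : E n) : ℝ := z i * ψ - supportFn (D.F i x) ψ

/-- `hᵢ(x, z) = max_{ψ ∈ S₁} max {0, ℓᵢ(ψ, x, z)}`. -/
def hi (i : Fin n) (x z : E n) : ℝ := sSup ((fun ψ => max 0 (D.ell i ψ x z)) '' S1)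

lemma hi_eq (i : Fin n) (x z : E n) :
    D.hi i x z = max (max 0 (D.ell i 1 x z)) (max 0 (D.ell i (-1) x z)) := by
  rw [hi, S1_eq, image_pair, csSup_pair]

/-- `h = (h₁, …, hₙ)`. -/
def h (x z : E n) : E n := WithLp.toLp 2 fun i => D.hi i x z

open Classical in
/-- `ψᵢ*(x, z)`: the maximizer of `ℓᵢ(·, x, z)` over `S₁ = {1, -1}` if `hᵢ(x, z) > 0`, and the fixed
element `ψᵢ⁰` of `S₁` otherwise. -/
def psiStar (ψ₀ : Fin n → ℝ) (i : Fin n) (x z : E n) : ℝ :=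
  if 0 < D.hi i x z then (if D.ell i (-1) x z ≤ D.ell i 1 x z then 1 else -1) else ψ₀ i

lemma psiStar_isMaxOn (ψ₀ : Fin n → ℝ) {i : Fin n} {x z : E n} (hpos : 0 < D.hi i x z) :
    D.psiStar ψ₀ i x z ∈ S1 ∧
      IsMaxOn (fun ψ => D.ell i ψ x z) S1 (D.psiStar ψ₀ i x z) := by
  rw [psiStar, if_pos hpos, S1_eq]
  split_ifs with hle
  · refine ⟨by simp, isMaxOn_iff.2 fun ψ hψ => ?_⟩
    rcases hψ with rfl | rfl
    · exact le_rfl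
    · exact hle
  · refine ⟨by simp, isMaxOn_iff.2 fun ψ hψ => ?_⟩
    rcases hψ with rfl | rfl
    · exact (not_le.1 hle).le
    · exact le_rfl

/-- The indices of the functions `f_{i, j_q}(x) ψ` active in the `j`-th maximum. -/
def R1 (i : Fin n) (j : Fin D.r) (x : E n) (ψ : ℝ) : Set (Fin (D.m j)) :=
  {q | D.f i j q x * ψ = ⨆ q', D.f i j q' x * ψ}

/-- The indices of the functions `g_{i, j_p}(x, ψ)` active in the `j`-th minimum. -/
def R2 (i : Fin n) (j : Fin D.s) (x : E n) (ψ : ℝ) : Set (Fin (D.k j)) :=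
  {p | D.g i j p x ψ = ⨅ p', D.g i j p' x ψ}

/-- The superdifferential at `x` of `-max_q f_{i, j_q}(·) ψ`, regarded as a function on `ℝⁿ × ℝⁿ`. -/
def superdiffNegMax (i : Fin n) (j : Fin D.r) (x : E n) (ψ : ℝ) : Set (E2 n) :=
  convexHull ℝ ((fun q => WithLp.toLp 2 (-(ψ • gradient (D.f i j q) x), (0 : E n))) ''
    D.R1 i j x ψ)

/-- The subdifferential at `x` of `-min_p g_{i, j_p}(·, ψ)`, regarded as a function on `ℝⁿ × ℝⁿ`. -/
def subdiffNegMin (i : Fin n) (j : Fin D.s) (x : E n) (ψ : ℝ) : Set (E2 n) :=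
  convexHull ℝ ((fun p => WithLp.toLp 2 (-gradient (fun y => D.g i j p y ψ) x, (0 : E n))) ''
    D.R2 i j x ψ)

/-- The superdifferential of `½ hᵢ²` at `(x, z)`. -/
def superdiffHalfSq (ψ₀ : Fin n → ℝ) (i : Fin n) (x z : E n) : Set (E2 n) :=
  D.hi i x z •
    ({WithLp.toLp 2 ((0 : E n), EuclideanSpace.single i (D.psiStar ψ₀ i x z))} +
      ∑ j, D.superdiffNegMax i j x (D.psiStar ψ₀ i x z))

/-- The subdifferential of `½ hᵢ²` at `(x, z)`. -/
def subdiffHalfSq (ψ₀ : Fin n → ℝ) (i : Fin n) (x z : E n) : Set (E2 n) :=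
  D.hi i x z • ∑ j, D.subdiffNegMin i j x (D.psiStar ψ₀ i x z)

/-- The superdifferential of `h² = ‖h‖² = ∑ᵢ hᵢ²` at `(x, z)`. -/
def superdiffSq (ψ₀ : Fin n → ℝ) (x z : E n) : Set (E2 n) :=
  (2 : ℝ) • ∑ i, D.superdiffHalfSq ψ₀ i x z

/-- The subdifferential of `h² = ‖h‖² = ∑ᵢ hᵢ²` at `(x, z)`. -/
def subdiffSq (ψ₀ : Fin n → ℝ) (x z : E n) : Set (E2 n) :=
  (2 : ℝ) • ∑ i, D.subdiffHalfSq ψ₀ i x z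

variable {T : ℝ}

/-- `φ(x, z) = ½ ∫₀ᵀ ‖h(x(t), z(t))‖² dt`. -/
def phi (p : X T n) : ℝ := 1 / 2 * ∫ t, ‖D.h (p.x t) (p.z t)‖ ^ 2 ∂leb T

/-- `[0,T]` is divided into finitely many intervals such that in each of them, in every maximum and
every minimum, one or several fixed functions are active along `p = (x, z)`. Activity is
only asked for at the instants when the value `ψ ∈ S₁` in question is `ψᵢ*(x(t), z(t))`. -/
def PiecewiseActive (ψ₀ : Fin n → ℝ) (p : X T n) : Prop :=
  ∃ (N : ℕ) (I : Fin N → Set (Icc (0 : ℝ) T)),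
    (∀ l, (I l).OrdConnected) ∧ Pairwise (fun l l' => Disjoint (I l) (I l')) ∧
    (⋃ l, I l) = univ ∧
    ∀ l i, ∀ ψ ∈ S1,
      (∀ j, ∃ A : Set (Fin (D.m j)), A.Nonempty ∧
        ∀ t ∈ I l, D.psiStar ψ₀ i (p.x t) (p.z t) = ψ → A ⊆ D.R1 i j (p.x t) ψ) ∧
      (∀ j, ∃ A : Set (Fin (D.k j)), A.Nonempty ∧
        ∀ t ∈ I l, D.psiStar ψ₀ i (p.x t) (p.z t) = ψ → A ⊆ D.R2 i j (p.x t) ψ)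

end Inclusion

/-- The functionals `g ↦ ∫₀ᵀ ⟨v₁(t), g₁(t)⟩ dt + ∫₀ᵀ ⟨v₂(t), g₂(t)⟩ dt` in the dual of
`C_n[0,T] × P_n[0,T]` with `v₁, v₂ ∈ L^∞_n[0,T]` and `(v₁(t), v₂(t)) ∈ K(t)` for all `t`. -/
def integralFunctionals {T : ℝ} {n : ℕ} (K : Icc (0 : ℝ) T → Set (E2 n)) :
    Set (WeakDual ℝ (X T n)) :=
  {v | ∃ v₁ v₂ : Icc (0 : ℝ) T → E n,
    MemLp v₁ ∞ (leb T) ∧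
    MemLp v₂ ∞ (leb T) ∧
    (∀ t, WithLp.toLp 2 (v₁ t, v₂ t) ∈ K t) ∧
    ∀ g : X T n, v g = (∫ t, inner ℝ (v₁ t) (g.x t) ∂leb T) + ∫ t, inner ℝ (v₂ t) (g.z t) ∂leb T}

end QuasiInclusion

end

noncomputable section

namespace QuasiInclusion

/-! ### Weak* compactness of sets of integral functionals -/

/-! Pointwise part. As `Fᵢ(x)` is nonempty, `c(Fᵢ(x), 1) + c(Fᵢ(x), -1) ≥ 0`, so at most one of
`ℓᵢ(1)`, `ℓᵢ(-1)` is positive (`ell_add_ell_neg_nonpos`) and `hᵢ²` is the sum of the squares of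
their positive parts (`hi_sq`). Squaring removes the kink of the positive part at zero
(`hasDerivAt_posPart_sq`), so the chain rule gives `hᵢ²` the directional derivative `2 hᵢ · ℓᵢ'(ψᵢ*;
d)`; where `hᵢ = 0` the choice of `ψᵢ⁰` is immaterial. By Danskin's rule (`hasDerivWithinAt_iSup`,
`hasDerivWithinAt_iInf`) a finite maximum has as one-sided derivative the largest active slope, and
a finite minimum the smallest. Both enter `ℓᵢ` with a minus sign, so the maxima feed the
superdifferential and the minima the subdifferential. Support values respect Minkowski sums,
nonnegative multiples and convex hulls, which assembles the sets.

Integral part. `‖h‖²` is locally Lipschitz, hence bounded and measurable along a curve, and its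
difference quotients along two bounded curves have a constant bound; dominated convergence then
differentiates `φ` under the integral (`tendsto_phi`). The integral of the pointwise maxima is a
maximum over integral functionals because maximizers can be selected measurably from finitely many
active gradients (`hasMaxSelection_convexHull`, `isGreatest_integralFunctionals`). Weak* compactness
is obtained in `L² × L²`: the selections form a closed convex bounded set, compact in the weak*
topology via Riesz, and restriction of functionals to `C_n × P_n` is weak* continuous
(`isCompact_integralFunctionals`). -/

/-- Under the Riesz isomorphism, a closed convex bounded subset of a Hilbert space is weakly*
compact. -/
lemma isCompact_toDual_image {H : Type*} [NormedAddCommGroup H] [InnerProductSpace ℝ H]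
    [CompleteSpace H] {C : Set H} (hconv : Convex ℝ C) (hclosed : IsClosed C)
    (hbdd : Bornology.IsBounded C) :
    IsCompact ((fun u => StrongDual.toWeakDual (InnerProductSpace.toDual ℝ H u)) '' C) := by
  apply WeakDual.isCompact_of_bounded_of_closed
  · obtain ⟨R, hR⟩ := hbdd.exists_norm_le
    rw [← WeakDual.isBounded_toWeakDual_preimage_iff_isBounded]
    refine (Metric.isBounded_closedBall (x := (0 : StrongDual ℝ H)) (r := R)).subset ?_
    rintro φ ⟨u, hu, hφ⟩
    have : φ = InnerProductSpace.toDual ℝ H u :=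
      StrongDual.toWeakDual.injective hφ.symm
    rw [mem_closedBall_zero_iff, this, LinearIsometryEquiv.norm_map]
    exact hR u hu
  · rw [← isOpen_compl_iff, isOpen_iff_mem_nhds]
    intro φ hφ
    set u := (InnerProductSpace.toDual ℝ H).symm (WeakDual.toStrongDual φ) with hu
    have hφu : ∀ w, φ w = inner ℝ u w := fun w => by
      rw [hu, InnerProductSpace.toDual_symm_apply]; rfl
    have huC : u ∉ C := by
      intro huC
      refine hφ ⟨u, huC, ?_⟩
      refine DFunLike.ext _ _ fun w => ?_
      rw [hφu]
      rfl
    -- Strict separation of `u` from `C` by a vector `w`: evaluation at `w` is weak* continuous, so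
    -- `s < φ' w` defines a weak* neighbourhood of `φ` that misses the image.
    obtain ⟨f, s, hs, hsu⟩ := geometric_hahn_banach_closed_point hconv hclosed huC
    set w := (InnerProductSpace.toDual ℝ H).symm f with hw
    have hf : ∀ v, f v = inner ℝ w v := fun v => by
      rw [hw, InnerProductSpace.toDual_symm_apply]
    have hmem : φ ∈ {φ' : WeakDual ℝ H | s < φ' w} := by
      rw [mem_ofPred_eq, hφu, real_inner_comm, ← hf]
      exact hsu
    refine mem_of_superset
      ((isOpen_lt continuous_const (WeakDual.eval_continuous w)).mem_nhds hmem) ?_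
    rintro φ' hφ' ⟨v, hv, rfl⟩
    have h1 := hs v hv
    have h2 : s < inner ℝ v w := hφ'
    rw [hf, real_inner_comm] at h1
    exact lt_irrefl _ (h1.trans h2)

section IntegralFunctionals

variable {T : ℝ} {n : ℕ}

/-- The Hilbert space `L²_n[0,T] × L²_n[0,T]`. -/
abbrev L2Prod (T : ℝ) (n : ℕ) : Type :=
  WithLp 2 (Lp (E n) 2 (leb T) × Lp (E n) 2 (leb T))

/-- The isometric map `C_n[0,T] × P_n[0,T] → L²_n[0,T] × L²_n[0,T]`. -/
def toL2CLM : X T n →L[ℝ] L2Prod T n :=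
  X.toL2.mkContinuous 1 fun p => by rw [one_mul]; exact le_rfl

/-- The functional on `C_n[0,T] × P_n[0,T]` represented by an element of
`L²_n[0,T] × L²_n[0,T]`. -/
def l2Functional (u : L2Prod T n) : WeakDual ℝ (X T n) :=
  StrongDual.toWeakDual ((InnerProductSpace.toDual ℝ (L2Prod T n) u).comp toL2CLM)

lemma l2Functional_apply (u : L2Prod T n) (g : X T n) :
    l2Functional u g =
      (∫ t, inner ℝ (u.fst t) (g.x t) ∂leb T) + ∫ t, inner ℝ (u.snd t) (g.z t) ∂leb T := by
  have h : l2Functional u g = inner ℝ u (X.toL2 g) := rfl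
  rw [h, WithLp.prod_inner_apply, L2.inner_def, L2.inner_def]
  congr 1
  · refine integral_congr_ae ?_
    filter_upwards [(memLp_continuous g.1).coeFn_toLp] with t ht
    exact congrArg (inner ℝ (u.fst t)) ht
  · refine integral_congr_ae ?_
    filter_upwards [(memLp_piecewise g.2).coeFn_toLp] with t ht
    exact congrArg (inner ℝ (u.snd t)) ht

lemma l2Functional_toLp {v₁ v₂ : Icc (0 : ℝ) T → E n} (h₁ : MemLp v₁ 2 (leb T))
    (h₂ : MemLp v₂ 2 (leb T)) (g : X T n) :
    l2Functional (WithLp.toLp 2 (h₁.toLp v₁, h₂.toLp v₂)) g =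
      (∫ t, inner ℝ (v₁ t) (g.x t) ∂leb T) + ∫ t, inner ℝ (v₂ t) (g.z t) ∂leb T := by
  rw [l2Functional_apply]
  congr 1
  · refine integral_congr_ae ?_
    filter_upwards [h₁.coeFn_toLp] with t ht
    exact congrArg (fun y => inner ℝ y (g.x t)) ht
  · refine integral_congr_ae ?_
    filter_upwards [h₂.coeFn_toLp] with t ht
    exact congrArg (fun y => inner ℝ y (g.z t)) ht

/-- The pairs of `L²` functions with values almost everywhere in the sets `K t`. -/
def l2Selections (K : Icc (0 : ℝ) T → Set (E2 n)) : Set (L2Prod T n) :=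
  {u | ∀ᵐ t ∂leb T, WithLp.toLp 2 (u.fst t, u.snd t) ∈ K t}

variable {K : Icc (0 : ℝ) T → Set (E2 n)}

lemma convex_l2Selections (hK : ∀ t, Convex ℝ (K t)) : Convex ℝ (l2Selections K) := by
  intro u hu v hv a b ha hb hab
  filter_upwards [hu, hv, Lp.coeFn_add (a • u.fst) (b • v.fst), Lp.coeFn_smul a u.fst,
    Lp.coeFn_smul b v.fst, Lp.coeFn_add (a • u.snd) (b • v.snd), Lp.coeFn_smul a u.snd,
    Lp.coeFn_smul b v.snd] with t h1 h2 h3 h4 h5 h6 h7 h8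
  have key := hK t h1 h2 ha hb hab
  have e1 : (a • u + b • v).fst t = a • u.fst t + b • v.fst t := by
    have : (a • u + b • v).fst t = (a • u.fst + b • v.fst : Lp (E n) 2 (leb T)) t := rfl
    rw [this, h3, Pi.add_apply, h4, h5]; rfl
  have e2 : (a • u + b • v).snd t = a • u.snd t + b • v.snd t := by
    have : (a • u + b • v).snd t = (a • u.snd + b • v.snd : Lp (E n) 2 (leb T)) t := rfl
    rw [this, h6, Pi.add_apply, h7, h8]; rfl
  rw [e1, e2]
  exact key

/-- `L²` convergence yields almost everywhere convergence along a subsequence. The subsequence for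
the second component is extracted from the one for the first, so that both converge together. -/
lemma isClosed_l2Selections (hK : ∀ t, IsClosed (K t)) : IsClosed (l2Selections K) := by
  rw [← isSeqClosed_iff_isClosed]
  intro u v hu huv
  have h1 : Tendsto (fun k => (u k).fst) atTop (𝓝 v.fst) :=
    ((WithLp.fstL 2 ℝ _ _).continuous.tendsto v).comp huv
  have h2 : Tendsto (fun k => (u k).snd) atTop (𝓝 v.snd) :=
    ((WithLp.sndL 2 ℝ _ _).continuous.tendsto v).comp huv
  obtain ⟨a, ha, hat⟩ := (tendstoInMeasure_of_tendsto_Lp h1).exists_seq_tendsto_ae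
  obtain ⟨b, hb, hbt⟩ := (tendstoInMeasure_of_tendsto_Lp
    (h2.comp ha.tendsto_atTop)).exists_seq_tendsto_ae
  have hall : ∀ᵐ t ∂leb T, ∀ k, WithLp.toLp 2 ((u k).fst t, (u k).snd t) ∈ K t :=
    ae_all_iff.2 hu
  filter_upwards [hat, hbt, hall] with t t1 t2 t3
  refine (hK t).mem_of_tendsto (b := atTop)
    (f := fun k => WithLp.toLp 2 ((u (a (b k))).fst t, (u (a (b k))).snd t)) ?_
    (Eventually.of_forall fun k => t3 _)
  exact ((WithLp.prod_continuous_toLp 2 (E n) (E n)).tendsto _).comp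
    ((t1.comp hb.tendsto_atTop).prodMk_nhds t2)

lemma isBounded_l2Selections {R : ℝ} (hR : 0 ≤ R) (hK : ∀ t, ∀ v ∈ K t, ‖v‖ ≤ R) :
    Bornology.IsBounded (l2Selections K) := by
  set c : ℝ := (measureUnivNNReal (leb T) : ℝ) ^ (2 : ℝ≥0∞).toReal⁻¹ * R
  have hc : 0 ≤ c := by positivity
  refine isBounded_iff_forall_norm_le.2 ⟨c + c, fun u hu => ?_⟩
  have h1 : ‖u.fst‖ ≤ c := by
    refine Lp.norm_le_of_ae_bound hR ?_
    filter_upwards [hu] with t ht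
    exact (WithLp.norm_fst_le (x := WithLp.toLp 2 (u.fst t, u.snd t))).trans (hK t _ ht)
  have h2 : ‖u.snd‖ ≤ c := by
    refine Lp.norm_le_of_ae_bound hR ?_
    filter_upwards [hu] with t ht
    exact (WithLp.norm_snd_le (x := WithLp.toLp 2 (u.fst t, u.snd t))).trans (hK t _ ht)
  rw [WithLp.prod_norm_eq_of_L2]
  refine Real.sqrt_le_iff.2 ⟨by positivity, ?_⟩
  nlinarith [norm_nonneg u.fst, norm_nonneg u.snd]

/-- Passes between "for all `t`" and "almost every `t`": an `L²` selection is redefined on the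
exceptional null set by arbitrary points of the nonempty sets `K t`. The common bound `R` makes the
result essentially bounded. -/
lemma integralFunctionals_eq_image {R : ℝ} (hne : ∀ t, (K t).Nonempty)
    (hK : ∀ t, ∀ v ∈ K t, ‖v‖ ≤ R) :
    integralFunctionals K = l2Functional '' l2Selections K := by
  classical
  ext v
  constructor
  · rintro ⟨v₁, v₂, h₁, h₂, hmem, hv⟩
    have h₁' : MemLp v₁ 2 (leb T) := h₁.mono_exponent le_top
    have h₂' : MemLp v₂ 2 (leb T) := h₂.mono_exponent le_top
    let u : L2Prod T n := WithLp.toLp 2 (h₁'.toLp v₁, h₂'.toLp v₂)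
    refine ⟨u, ?_, ?_⟩
    · filter_upwards [h₁'.coeFn_toLp, h₂'.coeFn_toLp] with t t₁ t₂
      change WithLp.toLp 2 (h₁'.toLp v₁ t, h₂'.toLp v₂ t) ∈ K t
      rw [t₁, t₂]
      exact hmem t
    · refine DFunLike.ext _ _ fun g => ?_
      rw [l2Functional_toLp, hv]
  · rintro ⟨u, hu, rfl⟩
    choose k hk using hne
    let v : Icc (0 : ℝ) T → E2 n := fun t =>
      if WithLp.toLp 2 (u.fst t, u.snd t) ∈ K t then WithLp.toLp 2 (u.fst t, u.snd t) else k t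
    have hv : ∀ t, v t ∈ K t := fun t => by
      by_cases h : WithLp.toLp 2 (u.fst t, u.snd t) ∈ K t
      · simpa only [v, if_pos h] using h
      · simpa only [v, if_neg h] using hk t
    have hvu : ∀ᵐ t ∂leb T, v t = WithLp.toLp 2 (u.fst t, u.snd t) := by
      filter_upwards [hu] with t ht
      exact if_pos ht
    have e₁ : (fun t => (v t).fst) =ᵐ[leb T] u.fst := hvu.mono fun t ht => congrArg WithLp.fst ht
    have e₂ : (fun t => (v t).snd) =ᵐ[leb T] u.snd := hvu.mono fun t ht => congrArg WithLp.snd ht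
    refine ⟨fun t => (v t).fst, fun t => (v t).snd,
      MemLp.of_bound ((Lp.aestronglyMeasurable u.fst).congr e₁.symm) R
        (Eventually.of_forall fun t => (WithLp.norm_fst_le (x := v t)).trans (hK t _ (hv t))),
      MemLp.of_bound ((Lp.aestronglyMeasurable u.snd).congr e₂.symm) R
        (Eventually.of_forall fun t => (WithLp.norm_snd_le (x := v t)).trans (hK t _ (hv t))),
      hv, fun g => ?_⟩
    rw [l2Functional_apply]
    congr 1
    · refine integral_congr_ae ?_
      filter_upwards [e₁] with t ht
      exact congrArg (fun y => inner ℝ y (g.x t)) ht.symm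
    · refine integral_congr_ae ?_
      filter_upwards [e₂] with t ht
      exact congrArg (fun y => inner ℝ y (g.z t)) ht.symm

/-- The Riesz argument lives in the Hilbert space `L² × L²`; the compact set found there is carried
over by the weak* continuous precomposition with `toL2CLM`. -/
lemma isCompact_integralFunctionals {R : ℝ} (hR : 0 ≤ R) (hne : ∀ t, (K t).Nonempty)
    (hconv : ∀ t, Convex ℝ (K t)) (hclosed : ∀ t, IsClosed (K t))
    (hK : ∀ t, ∀ v ∈ K t, ‖v‖ ≤ R) : IsCompact (integralFunctionals K) := by
  let pull : WeakDual ℝ (L2Prod T n) → WeakDual ℝ (X T n) := fun φ =>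
    StrongDual.toWeakDual ((WeakDual.toStrongDual φ).comp toL2CLM)
  have hpull : Continuous pull :=
    WeakDual.continuous_of_continuous_eval fun g => WeakDual.eval_continuous (toL2CLM g)
  have h := (isCompact_toDual_image (convex_l2Selections hconv) (isClosed_l2Selections hclosed)
    (isBounded_l2Selections hR hK)).image hpull
  rw [image_image] at h
  rw [integralFunctionals_eq_image hne hK]
  exact h

lemma convex_integralFunctionals {R : ℝ} (hne : ∀ t, (K t).Nonempty)
    (hconv : ∀ t, Convex ℝ (K t)) (hK : ∀ t, ∀ v ∈ K t, ‖v‖ ≤ R) :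
    Convex ℝ (integralFunctionals K) := by
  rw [integralFunctionals_eq_image hne hK]
  rintro _ ⟨u, hu, rfl⟩ _ ⟨v, hv, rfl⟩ a b ha hb hab
  refine ⟨a • u + b • v, convex_l2Selections hconv hu hv ha hb hab, ?_⟩
  refine DFunLike.ext _ _ fun g => ?_
  change inner ℝ (a • u + b • v) (X.toL2 g) =
    a * inner ℝ u (X.toL2 g) + b * inner ℝ v (X.toL2 g)
  rw [inner_add_left, real_inner_smul_left, real_inner_smul_left]

end IntegralFunctionals

/-! ### Support values of sets -/

section SupportValues

variable {H : Type*} [NormedAddCommGroup H] [InnerProductSpace ℝ H]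

/-- Reversing the direction `d` turns every rule for maxima below into the rule for minima. -/
lemma isLeast_inner_iff {A : Set H} {d : H} {b : ℝ} :
    IsLeast ((fun v => inner ℝ v d) '' A) b ↔ IsGreatest ((fun v => inner ℝ v (-d)) '' A) (-b) := by
  simp only [IsLeast, IsGreatest, mem_image, mem_upperBounds, mem_lowerBounds,
    forall_exists_index, and_imp, forall_apply_eq_imp_iff₂, inner_neg_right, neg_inj, neg_le_neg_iff]

lemma isGreatest_inner_add {A B : Set H} {d : H} {a b : ℝ}
    (hA : IsGreatest ((fun v => inner ℝ v d) '' A) a)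
    (hB : IsGreatest ((fun v => inner ℝ v d) '' B) b) :
    IsGreatest ((fun v => inner ℝ v d) '' (A + B)) (a + b) := by
  obtain ⟨⟨u, hu, hua⟩, hA⟩ := hA
  obtain ⟨⟨v, hv, hvb⟩, hB⟩ := hB
  dsimp only at hua hvb
  refine ⟨⟨u + v, add_mem_add hu hv, ?_⟩, ?_⟩
  · simp only [inner_add_left, hua, hvb]
  · rintro _ ⟨_, ⟨u', hu', v', hv', rfl⟩, rfl⟩
    simp only [inner_add_left]
    exact add_le_add (hA (mem_image_of_mem _ hu')) (hB (mem_image_of_mem _ hv'))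

lemma isGreatest_inner_sum {ι : Type*} (s : Finset ι) {A : ι → Set H} {d : H} {a : ι → ℝ}
    (h : ∀ i, IsGreatest ((fun v => inner ℝ v d) '' A i) (a i)) :
    IsGreatest ((fun v => inner ℝ v d) '' (∑ i ∈ s, A i)) (∑ i ∈ s, a i) := by
  classical
  induction s using Finset.induction_on with
  | empty => simp
  | insert i s hi ih =>
    rw [Finset.sum_insert hi, Finset.sum_insert hi]
    exact isGreatest_inner_add (h i) ih

lemma isGreatest_inner_smul {A : Set H} {d : H} {a c : ℝ} (hc : 0 ≤ c)
    (hA : IsGreatest ((fun v => inner ℝ v d) '' A) a) :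
    IsGreatest ((fun v => inner ℝ v d) '' (c • A)) (c * a) := by
  obtain ⟨⟨u, hu, hua⟩, hA⟩ := hA
  refine ⟨⟨c • u, smul_mem_smul_set hu, ?_⟩, ?_⟩
  · simp only [real_inner_smul_left, hua]
  · rintro _ ⟨_, ⟨u', hu', rfl⟩, rfl⟩
    simp only [real_inner_smul_left]
    exact mul_le_mul_of_nonneg_left (hA (mem_image_of_mem _ hu')) hc

lemma inner_le_of_mem_convexHull {S : Set H} {d v : H} {c : ℝ} (h : ∀ w ∈ S, inner ℝ w d ≤ c)
    (hv : v ∈ convexHull ℝ S) : inner ℝ v d ≤ c := by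
  have hconv : Convex ℝ {w : H | inner ℝ w d ≤ c} :=
    convex_halfSpace_le ⟨fun _ _ => inner_add_left _ _ _, fun _ _ => real_inner_smul_left _ _ _⟩ c
  exact convexHull_min (fun w hw => h w hw) hconv hv

/-- A linear functional on a convex hull is maximized at a generator, so only the active gradients
need comparing. -/
lemma isGreatest_inner_convexHull {ι : Type*} {R : Set ι} {w : ι → H} {d : H} {a : ℝ}
    (h : IsGreatest ((fun q => inner ℝ (w q) d) '' R) a) :
    IsGreatest ((fun v => inner ℝ v d) '' convexHull ℝ (w '' R)) a := by
  obtain ⟨⟨q, hq, hqa⟩, h⟩ := h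
  refine ⟨⟨w q, subset_convexHull ℝ _ (mem_image_of_mem _ hq), hqa⟩, ?_⟩
  rintro _ ⟨v, hv, rfl⟩
  refine inner_le_of_mem_convexHull ?_ hv
  rintro _ ⟨q', hq', rfl⟩
  exact h (mem_image_of_mem _ hq')

lemma isLeast_inner_singleton (v d : H) :
    IsLeast ((fun v => inner ℝ v d) '' {v}) (inner ℝ v d) := by
  rw [image_singleton]
  exact isLeast_singleton

lemma isLeast_inner_add {A B : Set H} {d : H} {a b : ℝ}
    (hA : IsLeast ((fun v => inner ℝ v d) '' A) a)
    (hB : IsLeast ((fun v => inner ℝ v d) '' B) b) :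
    IsLeast ((fun v => inner ℝ v d) '' (A + B)) (a + b) := by
  rw [isLeast_inner_iff] at *
  rw [neg_add]
  exact isGreatest_inner_add hA hB

lemma isLeast_inner_sum {ι : Type*} (s : Finset ι) {A : ι → Set H} {d : H} {a : ι → ℝ}
    (h : ∀ i, IsLeast ((fun v => inner ℝ v d) '' A i) (a i)) :
    IsLeast ((fun v => inner ℝ v d) '' (∑ i ∈ s, A i)) (∑ i ∈ s, a i) := by
  rw [isLeast_inner_iff, ← Finset.sum_neg_distrib]
  exact isGreatest_inner_sum s fun i => isLeast_inner_iff.1 (h i)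

lemma isLeast_inner_smul {A : Set H} {d : H} {a c : ℝ} (hc : 0 ≤ c)
    (hA : IsLeast ((fun v => inner ℝ v d) '' A) a) :
    IsLeast ((fun v => inner ℝ v d) '' (c • A)) (c * a) := by
  rw [isLeast_inner_iff] at *
  rw [← mul_neg]
  exact isGreatest_inner_smul hc hA

lemma isLeast_inner_convexHull {ι : Type*} {R : Set ι} {w : ι → H} {d : H} {a : ℝ}
    (h : IsLeast ((fun q => inner ℝ (w q) d) '' R) a) :
    IsLeast ((fun v => inner ℝ v d) '' convexHull ℝ (w '' R)) a := by
  rw [isLeast_inner_iff]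
  refine isGreatest_inner_convexHull ?_
  obtain ⟨⟨q, hq, rfl⟩, h⟩ := h
  refine ⟨⟨q, hq, inner_neg_right _ _⟩, ?_⟩
  rintro _ ⟨q', hq', rfl⟩
  simp only [inner_neg_right, neg_le_neg_iff]
  exact h (mem_image_of_mem _ hq')

/-- Nonempty convex compact sets. -/
def IsConvexBody (A : Set H) : Prop := Convex ℝ A ∧ IsCompact A ∧ A.Nonempty

lemma IsConvexBody.add {A B : Set H} (hA : IsConvexBody A) (hB : IsConvexBody B) :
    IsConvexBody (A + B) :=
  ⟨hA.1.add hB.1, hA.2.1.add hB.2.1, hA.2.2.add hB.2.2⟩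

lemma isConvexBody_singleton (v : H) : IsConvexBody {v} :=
  ⟨convex_singleton v, isCompact_singleton, singleton_nonempty v⟩

lemma IsConvexBody.sum {ι : Type*} (s : Finset ι) {A : ι → Set H} (h : ∀ i, IsConvexBody (A i)) :
    IsConvexBody (∑ i ∈ s, A i) :=
  Finset.sum_induction _ _ (fun _ _ => IsConvexBody.add) (isConvexBody_singleton 0) fun i _ => h i

lemma IsConvexBody.smul {A : Set H} (hA : IsConvexBody A) (c : ℝ) : IsConvexBody (c • A) :=
  ⟨hA.1.smul c, hA.2.1.smul c, hA.2.2.smul_set⟩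

lemma isConvexBody_convexHull {S : Set H} (hS : S.Finite) (hne : S.Nonempty) :
    IsConvexBody (convexHull ℝ S) :=
  ⟨convex_convexHull ℝ S, hS.isCompact_convexHull ℝ, hne.convexHull⟩

end SupportValues

/-! ### Uniformly bounded families of sets -/

section Bounded

variable {α H : Type*} [NormedAddCommGroup H]

/-- The sets `K t` are contained in a common ball. -/
def UniformlyBounded (K : α → Set H) : Prop := ∃ R, 0 ≤ R ∧ ∀ t, ∀ v ∈ K t, ‖v‖ ≤ R

lemma UniformlyBounded.add {K L : α → Set H} (hK : UniformlyBounded K) (hL : UniformlyBounded L) :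
    UniformlyBounded fun t => K t + L t := by
  obtain ⟨R, hR, hK⟩ := hK
  obtain ⟨R', hR', hL⟩ := hL
  refine ⟨R + R', by positivity, ?_⟩
  rintro t _ ⟨v, hv, w, hw, rfl⟩
  exact (norm_add_le _ _).trans (add_le_add (hK t v hv) (hL t w hw))

lemma UniformlyBounded.sum {ι : Type*} (s : Finset ι) {K : ι → α → Set H}
    (h : ∀ i, UniformlyBounded (K i)) : UniformlyBounded fun t => ∑ i ∈ s, K i t := by
  classical
  induction s using Finset.induction_on with
  | empty => exact ⟨0, le_rfl, by simp⟩
  | insert i s hi ih =>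
    simp only [Finset.sum_insert hi]
    exact (h i).add ih

lemma UniformlyBounded.smul [NormedSpace ℝ H] {K : α → Set H} (hK : UniformlyBounded K)
    {c : α → ℝ} {C : ℝ}
    (hc : ∀ t, |c t| ≤ C) : UniformlyBounded fun t => c t • K t := by
  obtain ⟨R, hR, hK⟩ := hK
  refine ⟨|C| * R, by positivity, ?_⟩
  rintro t _ ⟨v, hv, rfl⟩
  dsimp only
  rw [norm_smul, Real.norm_eq_abs]
  exact mul_le_mul ((hc t).trans (le_abs_self C)) (hK t v hv) (norm_nonneg _) (abs_nonneg _)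

lemma UniformlyBounded.convexHull_image [NormedSpace ℝ H] {ι : Type*} [Finite ι]
    {w : ι → α → H} {R : α → Set ι} (hw : ∀ q, ∃ C, ∀ t, ‖w q t‖ ≤ C) :
    UniformlyBounded fun t => convexHull ℝ ((fun q => w q t) '' R t) := by
  have := Fintype.ofFinite ι
  choose C hC using hw
  refine ⟨∑ q, |C q|, by positivity, fun t v hv => ?_⟩
  have hsub : (fun q => w q t) '' R t ⊆ Metric.closedBall 0 (∑ q, |C q|) := by
    rintro _ ⟨q, -, rfl⟩
    rw [mem_closedBall_zero_iff]
    exact (hC q t).trans ((le_abs_self _).trans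
      (Finset.single_le_sum (f := fun q => |C q|) (fun _ _ => abs_nonneg _) (Finset.mem_univ q)))
  exact mem_closedBall_zero_iff.1 (convexHull_min hsub (convex_closedBall _ _) hv)

end Bounded

/-! ### Measurable selections of maximizers -/

section Selections

variable {α H : Type*} [MeasurableSpace α] [NormedAddCommGroup H]

/-- Induction on the finite index set: each new index takes precedence on its measurable set of good
points, and the earlier selection is kept elsewhere. -/
lemma exists_stronglyMeasurable_selection {ι : Type*} (s : Finset ι) {w : ι → α → H}
    (hw : ∀ q, StronglyMeasurable (w q)) {good : ι → α → Prop}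
    (hgood : ∀ q, MeasurableSet {t | good q t}) :
    ∃ v : α → H, StronglyMeasurable v ∧
      ∀ t, (∃ q ∈ s, good q t) → ∃ q ∈ s, good q t ∧ v t = w q t := by
  classical
  induction s using Finset.induction_on with
  | empty => exact ⟨0, stronglyMeasurable_zero, by simp⟩
  | insert a s ha ih =>
    obtain ⟨v, hv, hvs⟩ := ih
    refine ⟨fun t => if good a t then w a t else v t, StronglyMeasurable.ite (hgood a) (hw a) hv,
      fun t ht => ?_⟩
    by_cases h : good a t
    · exact ⟨a, Finset.mem_insert_self _ _, h, if_pos h⟩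
    · obtain ⟨q, hq, hqt⟩ := ht
      rcases Finset.mem_insert.1 hq with rfl | hqs
      · exact absurd hqt h
      · obtain ⟨q', hq', hg', he⟩ := hvs t ⟨q, hqs, hqt⟩
        exact ⟨q', Finset.mem_insert_of_mem hq', hg', (if_neg h).trans he⟩

variable [InnerProductSpace ℝ H]

/-- There is a measurable choice of points of `K t` at which `⟨·, d t⟩` attains its maximum. -/
def HasMaxSelection (K : α → Set H) (d : α → H) : Prop :=
  ∃ v : α → H, StronglyMeasurable v ∧
    ∀ t, v t ∈ K t ∧ ∀ w ∈ K t, inner ℝ w (d t) ≤ inner ℝ (v t) (d t)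

lemma hasMaxSelection_singleton {v : α → H} (hv : StronglyMeasurable v) (d : α → H) :
    HasMaxSelection (fun t => {v t}) d :=
  ⟨v, hv, fun t => ⟨rfl, by rintro _ rfl; rfl⟩⟩

lemma HasMaxSelection.add {K L : α → Set H} {d : α → H} (hK : HasMaxSelection K d)
    (hL : HasMaxSelection L d) : HasMaxSelection (fun t => K t + L t) d := by
  obtain ⟨v, hv, hvK⟩ := hK
  obtain ⟨w, hw, hwL⟩ := hL
  refine ⟨fun t => v t + w t, hv.add hw, fun t => ⟨add_mem_add (hvK t).1 (hwL t).1, ?_⟩⟩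
  rintro _ ⟨v', hv', w', hw', rfl⟩
  simp only [inner_add_left]
  exact add_le_add ((hvK t).2 _ hv') ((hwL t).2 _ hw')

lemma HasMaxSelection.sum {ι : Type*} (s : Finset ι) {K : ι → α → Set H} {d : α → H}
    (h : ∀ i, HasMaxSelection (K i) d) : HasMaxSelection (fun t => ∑ i ∈ s, K i t) d := by
  classical
  induction s using Finset.induction_on with
  | empty => exact hasMaxSelection_singleton stronglyMeasurable_zero d
  | insert i s hi ih =>
    simp only [Finset.sum_insert hi]
    exact (h i).add ih

lemma HasMaxSelection.smul {K : α → Set H} {d : α → H} (hK : HasMaxSelection K d) {c : α → ℝ}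
    (hc : StronglyMeasurable c) (hc0 : ∀ t, 0 ≤ c t) : HasMaxSelection (fun t => c t • K t) d := by
  obtain ⟨v, hv, hvK⟩ := hK
  refine ⟨fun t => c t • v t, hc.smul hv, fun t => ⟨smul_mem_smul_set (hvK t).1, ?_⟩⟩
  rintro _ ⟨v', hv', rfl⟩
  simp only [real_inner_smul_left]
  exact mul_le_mul_of_nonneg_left ((hvK t).2 _ hv') (hc0 t)

lemma HasMaxSelection.of_cases {K L M : α → Set H} {d : α → H} (hK : HasMaxSelection K d)
    (hL : HasMaxSelection L d) {p : α → Prop} (hp : MeasurableSet {t | p t})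
    (h₁ : ∀ t, p t → M t = K t) (h₂ : ∀ t, ¬ p t → M t = L t) : HasMaxSelection M d := by
  classical
  obtain ⟨v, hv, hvK⟩ := hK
  obtain ⟨w, hw, hwL⟩ := hL
  refine ⟨fun t => if p t then v t else w t, StronglyMeasurable.ite hp hv hw, fun t => ?_⟩
  by_cases h : p t
  · simpa only [if_pos h, h₁ t h] using hvK t
  · simpa only [if_neg h, h₂ t h] using hwL t

/-- The maximum over the hull is attained at one of finitely many vertices. An index is called good
at `t` if it is active there and beats every active competitor; this is a measurable condition, and
some index is always good. -/
lemma hasMaxSelection_convexHull {ι : Type*} [Finite ι] {w : ι → α → H} {d : α → H}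
    {R : α → Set ι} (hw : ∀ q, StronglyMeasurable (w q)) (hd : StronglyMeasurable d)
    (hR : ∀ q, MeasurableSet {t | q ∈ R t}) (hne : ∀ t, (R t).Nonempty) :
    HasMaxSelection (fun t => convexHull ℝ ((fun q => w q t) '' R t)) d := by
  have := Fintype.ofFinite ι
  let good : ι → α → Prop := fun q t =>
    q ∈ R t ∧ ∀ q', q' ∈ R t → inner ℝ (w q' t) (d t) ≤ inner ℝ (w q t) (d t)
  have hinner : ∀ q, Measurable fun t => inner ℝ (w q t) (d t) := fun q =>
    ((hw q).inner hd).measurable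
  have hgood : ∀ q, MeasurableSet {t | good q t} := fun q => by
    have : {t | good q t} = {t | q ∈ R t} ∩ ⋂ q', ({t | q' ∈ R t}ᶜ ∪
        {t | inner ℝ (w q' t) (d t) ≤ inner ℝ (w q t) (d t)}) := by
      ext t
      simp only [good, mem_ofPred_eq, mem_inter_iff, mem_iInter, mem_union, mem_compl_iff,
        imp_iff_not_or]
    rw [this]
    exact (hR q).inter (MeasurableSet.iInter fun q' =>
      (hR q').compl.union (measurableSet_le (hinner q') (hinner q)))
  obtain ⟨v, hv, hvs⟩ := exists_stronglyMeasurable_selection Finset.univ hw hgood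
  refine ⟨v, hv, fun t => ?_⟩
  obtain ⟨q₀, hq₀, hmax⟩ := (R t).toFinite.exists_maximalFor
    (fun q => inner ℝ (w q t) (d t)) (R t) (hne t)
  have hq₀' : good q₀ t := ⟨hq₀, fun q' hq' => by
    by_contra hlt
    exact hlt (hmax hq' (le_of_not_ge hlt))⟩
  obtain ⟨q, -, ⟨hqR, hqm⟩, he⟩ := hvs t ⟨q₀, Finset.mem_univ _, hq₀'⟩
  rw [he]
  refine ⟨subset_convexHull ℝ _ (mem_image_of_mem _ hqR), fun u hu => ?_⟩
  refine inner_le_of_mem_convexHull ?_ hu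
  rintro _ ⟨q', hq', rfl⟩
  exact hqm q' hq'

end Selections

/-! ### One-sided derivatives of maxima and minima -/

section OneSided

/-- Danskin's rule. The active function of steepest slope bounds the quotient of the maximum from
below. From above, active functions have no larger slope, and inactive ones are still too small for
small `α`. -/
lemma hasDerivWithinAt_iSup {ι : Type*} [Finite ι] [Nonempty ι] {φ : ι → ℝ → ℝ} {c : ι → ℝ}
    (h : ∀ q, HasDerivWithinAt (φ q) (c q) (Ioi 0) 0) :
    ∃ a, IsGreatest (c '' {q | φ q 0 = ⨆ q', φ q' 0}) a ∧
      HasDerivWithinAt (fun α => ⨆ q, φ q α) a (Ioi 0) 0 := by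
  have hbdd : ∀ α, BddAbove (range fun q => φ q α) := fun α => (finite_range _).bddAbove
  set R : Set ι := {q | φ q 0 = ⨆ q', φ q' 0} with hR
  have hne : R.Nonempty := by
    obtain ⟨q, hq⟩ := exists_eq_ciSup_of_finite (f := fun q => φ q 0)
    exact ⟨q, hq⟩
  obtain ⟨q₀, hq₀, hmax⟩ := R.toFinite.exists_maximalFor c R hne
  have hmax' : ∀ q ∈ R, c q ≤ c q₀ := fun q hq => by
    by_contra hlt
    exact hlt (hmax hq (le_of_not_ge hlt))
  refine ⟨c q₀, ⟨mem_image_of_mem _ hq₀, by rintro _ ⟨q, hq, rfl⟩; exact hmax' q hq⟩, ?_⟩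
  have hslope : ∀ q, Tendsto (fun α => α⁻¹ * (φ q α - φ q 0)) (𝓝[>] 0) (𝓝 (c q)) := fun q => by
    have := (hasDerivWithinAt_iff_tendsto_slope' (notMem_Ioi.2 le_rfl)).1 (h q)
    simpa [slope_fun_def] using this
  rw [hasDerivWithinAt_iff_tendsto_slope' (notMem_Ioi.2 le_rfl)]
  suffices Tendsto (fun α => α⁻¹ * ((⨆ q, φ q α) - ⨆ q, φ q 0)) (𝓝[>] 0) (𝓝 (c q₀)) by
    simpa [slope_fun_def] using this
  rw [tendsto_order]
  constructor
  · intro b hb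
    filter_upwards [(hslope q₀).eventually_const_lt hb, self_mem_nhdsWithin] with α hα hpos
    refine hα.trans_le (mul_le_mul_of_nonneg_left ?_ (inv_nonneg.2 (le_of_lt hpos)))
    have h1 : φ q₀ 0 = ⨆ q', φ q' 0 := hq₀
    have h2 := le_ciSup (hbdd α) q₀
    linarith
  · intro b hb
    have key : ∀ q, ∀ᶠ α in 𝓝[>] (0 : ℝ), α⁻¹ * (φ q α - ⨆ q', φ q' 0) < b := by
      intro q
      by_cases hq : q ∈ R
      · have h1 : φ q 0 = ⨆ q', φ q' 0 := hq
        rw [← h1]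
        exact (hslope q).eventually_lt_const ((hmax' q hq).trans_lt hb)
      · have h1 : φ q 0 < ⨆ q', φ q' 0 := lt_of_le_of_ne (le_ciSup (hbdd 0) q) hq
        -- An inactive function starts strictly below the maximum, so by continuity it remains below
        -- the line of slope `b` through the maximal value.
        have h2 : Tendsto (fun α : ℝ => φ q α - α * b) (𝓝[>] 0) (𝓝 (φ q 0 - 0 * b)) :=
          (h q).continuousWithinAt.tendsto.sub
            ((tendsto_id.mono_left nhdsWithin_le_nhds).mul_const b)
        rw [zero_mul, sub_zero] at h2
        filter_upwards [h2.eventually_lt_const h1, self_mem_nhdsWithin] with α hα hpos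
        rw [inv_mul_lt_iff₀ hpos]
        linarith
    filter_upwards [eventually_all.2 key] with α hα
    obtain ⟨q, hq⟩ := exists_eq_ciSup_of_finite (f := fun q => φ q α)
    rw [← hq]
    exact hα q

lemma hasDerivWithinAt_iInf {ι : Type*} [Finite ι] [Nonempty ι] {φ : ι → ℝ → ℝ} {c : ι → ℝ}
    (h : ∀ q, HasDerivWithinAt (φ q) (c q) (Ioi 0) 0) :
    ∃ a, IsLeast (c '' {q | φ q 0 = ⨅ q', φ q' 0}) a ∧
      HasDerivWithinAt (fun α => ⨅ q, φ q α) a (Ioi 0) 0 := by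
  have hneg : ∀ α, (⨅ q, φ q α) = -⨆ q, -φ q α := fun α => by
    rw [iInf, Real.sInf_def, iSup]
    congr 2
    ext y
    simp only [Set.mem_neg, mem_range, neg_eq_iff_eq_neg]
  obtain ⟨a, ⟨⟨q₀, hq₀, hqa⟩, hub⟩, hda⟩ := hasDerivWithinAt_iSup (fun q => (h q).neg)
  have hset : {q | φ q 0 = ⨅ q', φ q' 0} = {q | (-φ q) 0 = ⨆ q', (-φ q') 0} := by
    ext q
    change φ q 0 = _ ↔ -φ q 0 = ⨆ q', -φ q' 0
    rw [hneg, ← neg_eq_iff_eq_neg]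
  refine ⟨-a, ⟨⟨q₀, hset ▸ hq₀, by rw [← hqa, neg_neg]⟩, ?_⟩, ?_⟩
  · rintro _ ⟨q, hq, rfl⟩
    rw [hset] at hq
    have : -c q ≤ a := hub ⟨q, hq, rfl⟩
    linarith
  · exact hda.neg.congr (fun α _ => hneg α) (hneg 0)

/-- The square of the positive part is differentiable. -/
lemma hasDerivAt_posPart_sq (s : ℝ) :
    HasDerivAt (fun s : ℝ => (max 0 s) ^ 2) (2 * max 0 s) s := by
  rcases lt_trichotomy s 0 with hs | rfl | hs
  · rw [max_eq_left hs.le, mul_zero]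
    refine (hasDerivAt_const s (0 : ℝ)).congr_of_eventuallyEq ?_
    filter_upwards [eventually_lt_nhds hs] with y hy
    rw [max_eq_left hy.le]
    norm_num
  · rw [max_self, mul_zero, hasDerivAt_iff_isLittleO]
    have h1 : (fun y : ℝ => y ^ 2) =o[𝓝 0] fun y => y := by
      simpa using Asymptotics.isLittleO_pow_pow (𝕜 := ℝ) one_lt_two
    -- At zero the function is dominated by `y²`, which is `o(y)`.
    refine (Asymptotics.IsBigO.of_bound 1 ?_).trans_isLittleO (h1.congr_right fun y => by simp)
    refine Eventually.of_forall fun y => ?_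
    simp only [max_self, smul_zero, sub_zero, norm_pow, Real.norm_eq_abs, one_mul]
    norm_num
    rcases le_total y 0 with hy | hy
    · rw [max_eq_left hy]; nlinarith [sq_nonneg y]
    · rw [max_eq_right hy]
  · rw [max_eq_right hs.le]
    have := (hasDerivAt_pow 2 s)
    refine (this.congr_of_eventuallyEq ?_).congr_deriv (by norm_num)
    filter_upwards [eventually_gt_nhds hs] with y hy
    rw [max_eq_right hy.le]

end OneSided

/-! ### Derivatives along lines, and local Lipschitz continuity of finite sums, maxima and minima -/

lemma gradient_continuous {H : Type*} [NormedAddCommGroup H] [InnerProductSpace ℝ H]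
    [CompleteSpace H] {f : H → ℝ} (hf : ContDiff ℝ 1 f) : Continuous (gradient f) :=
  (InnerProductSpace.toDual ℝ H).symm.continuous.comp (hf.continuous_fderiv one_ne_zero)

lemma hasDerivWithinAt_line {H : Type*} [NormedAddCommGroup H] [InnerProductSpace ℝ H]
    [CompleteSpace H] {f : H → ℝ} (hf : ContDiff ℝ 1 f) (x d : H) :
    HasDerivWithinAt (fun α : ℝ => f (x + α • d)) (inner ℝ (gradient f x) d) (Ioi 0) 0 := by
  have h1 : HasFDerivAt f (InnerProductSpace.toDual ℝ H (gradient f x)) (x + (0 : ℝ) • d) := by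
    rw [zero_smul, add_zero]
    exact (hf.differentiable one_ne_zero x).hasGradientAt.hasFDerivAt
  have h2 : HasDerivAt (fun α : ℝ => x + α • d) d 0 := by
    simpa using ((hasDerivAt_id (0 : ℝ)).smul_const d).const_add x
  exact (h1.comp_hasDerivAt 0 h2).hasDerivWithinAt

lemma locallyLipschitz_sum {H ι : Type*} [PseudoEMetricSpace H] (s : Finset ι) {f : ι → H → ℝ}
    (h : ∀ i, LocallyLipschitz (f i)) : LocallyLipschitz fun y => ∑ i ∈ s, f i y := by
  classical
  induction s using Finset.induction_on with
  | empty => simpa using LocallyLipschitz.const (0 : ℝ)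
  | insert i s hi ih =>
    simp only [Finset.sum_insert hi]
    exact (h i).add ih

lemma locallyLipschitz_iSup {H ι : Type*} [PseudoEMetricSpace H] [Finite ι] [Nonempty ι]
    {f : ι → H → ℝ} (h : ∀ i, LocallyLipschitz (f i)) : LocallyLipschitz fun y => ⨆ i, f i y := by
  have := Fintype.ofFinite ι
  have key := Finset.sup'_induction (p := LocallyLipschitz) Finset.univ_nonempty f
    (fun _ h₁ _ h₂ => h₁.max h₂) fun i _ => h i
  convert key using 1
  ext y
  rw [Finset.sup'_apply, Finset.sup'_univ_eq_ciSup]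

lemma locallyLipschitz_iInf {H ι : Type*} [PseudoEMetricSpace H] [Finite ι] [Nonempty ι]
    {f : ι → H → ℝ} (h : ∀ i, LocallyLipschitz (f i)) : LocallyLipschitz fun y => ⨅ i, f i y := by
  have := Fintype.ofFinite ι
  have key := Finset.inf'_induction (p := LocallyLipschitz) Finset.univ_nonempty f
    (fun _ h₁ _ h₂ => h₁.min h₂) fun i _ => h i
  convert key using 1
  ext y
  rw [Finset.inf'_apply, Finset.inf'_univ_eq_ciInf]

/-! ### The functions `ℓᵢ` and `hᵢ`, the maximizer `ψᵢ*` and the active sets -/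

namespace Inclusion

variable {n : ℕ} {D : Inclusion n} {ψ₀ : Fin n → ℝ}

lemma psiStar_mem (hψ₀ : ∀ i, ψ₀ i ∈ S1) (i : Fin n) (x z : E n) : D.psiStar ψ₀ i x z ∈ S1 := by
  rw [psiStar, S1_eq]
  split_ifs
  · simp
  · simp
  · rw [← S1_eq]
    exact hψ₀ i

lemma hi_nonneg (i : Fin n) (x z : E n) : 0 ≤ D.hi i x z := by
  rw [hi_eq]
  exact le_max_of_le_left (le_max_left _ _)

lemma norm_h_sq (x z : E n) : ‖D.h x z‖ ^ 2 = ∑ i, D.hi i x z ^ 2 := by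
  rw [EuclideanSpace.real_norm_sq_eq]
  rfl

lemma R1_nonempty (hD : D.Admissible) (i : Fin n) (j : Fin D.r) (x : E n) (ψ : ℝ) :
    (D.R1 i j x ψ).Nonempty := by
  have := Fin.pos_iff_nonempty.1 (hD.m_pos j)
  obtain ⟨q, hq⟩ := exists_eq_ciSup_of_finite (f := fun q => D.f i j q x * ψ)
  exact ⟨q, hq⟩

lemma R2_nonempty (hD : D.Admissible) (i : Fin n) (j : Fin D.s) (x : E n) (ψ : ℝ) :
    (D.R2 i j x ψ).Nonempty := by
  have := Fin.pos_iff_nonempty.1 (hD.k_pos j)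
  obtain ⟨q, hq⟩ := exists_eq_ciInf_of_finite (f := fun q => D.g i j q x ψ)
  exact ⟨q, hq⟩

lemma isConvexBody_superdiffHalfSq (hD : D.Admissible) (i : Fin n) (x z : E n) :
    IsConvexBody (D.superdiffHalfSq ψ₀ i x z) :=
  ((isConvexBody_singleton _).add (IsConvexBody.sum _ fun j =>
    isConvexBody_convexHull (toFinite _) ((R1_nonempty hD i j x _).image _))).smul _

lemma isConvexBody_subdiffHalfSq (hD : D.Admissible) (i : Fin n) (x z : E n) :
    IsConvexBody (D.subdiffHalfSq ψ₀ i x z) :=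
  (IsConvexBody.sum _ fun j =>
    isConvexBody_convexHull (toFinite _) ((R2_nonempty hD i j x _).image _)).smul _

/-- The values of `ℓᵢ` at the two points of `S₁` have nonpositive sum. -/
lemma ell_add_ell_neg_nonpos (hD : D.Admissible) (i : Fin n) (x z : E n) :
    D.ell i 1 x z + D.ell i (-1) x z ≤ 0 := by
  -- A single point `a` bounds the two support values below by `a` and `-a`; in the sum these
  -- cancel, as do the terms `zᵢ` and `-zᵢ`.
  obtain ⟨a, ha⟩ := hD.nonempty i x
  have hle : ∀ ψ : ℝ, a * ψ ≤ supportFn (D.F i x) ψ := fun ψ =>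
    le_csSup ((hD.compact i x).image (continuous_mul_const ψ)).bddAbove (mem_image_of_mem _ ha)
  have h1 := hle 1
  have h2 := hle (-1)
  simp only [ell]
  linarith

lemma ell_eq (hD : D.Admissible) (i : Fin n) {ψ : ℝ} (hψ : ψ ∈ S1) (x z : E n) :
    D.ell i ψ x z =
      z i * ψ + (∑ j, -⨆ q, D.f i j q x * ψ) + ∑ j, -⨅ p, D.g i j p x ψ := by
  rw [ell, hD.support_eq i x ψ hψ, Finset.sum_neg_distrib, Finset.sum_neg_distrib]
  ring

/-- At most one positive part is nonzero, so the square of their maximum equals the sum of their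
squares. This removes the outer maximum over `ψ` before differentiating. -/
lemma hi_sq (hD : D.Admissible) (i : Fin n) (x z : E n) :
    D.hi i x z ^ 2 = max 0 (D.ell i 1 x z) ^ 2 + max 0 (D.ell i (-1) x z) ^ 2 := by
  have h := ell_add_ell_neg_nonpos hD i x z
  rw [hi_eq]
  rcases le_total (D.ell i 1 x z) 0 with h1 | h1
  · rw [max_eq_left h1, max_eq_right (le_max_left _ _)]
    ring
  · rw [max_eq_left (show D.ell i (-1) x z ≤ 0 by linarith), max_eq_left (le_max_left _ _)]
    ring

/-- Only the value at `ψᵢ*` contributes to a sum weighted by the positive parts of `ℓᵢ`. -/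
lemma posPart_ell_combination (hD : D.Admissible) (i : Fin n) (x z : E n) (L : ℝ → ℝ) :
    max 0 (D.ell i 1 x z) * L 1 + max 0 (D.ell i (-1) x z) * L (-1) =
      D.hi i x z * L (D.psiStar ψ₀ i x z) := by
  have h := ell_add_ell_neg_nonpos hD i x z
  rw [psiStar, hi_eq]
  rcases le_or_gt (D.ell i 1 x z) 0 with h1 | h1
  · rcases le_or_gt (D.ell i (-1) x z) 0 with h2 | h2
    -- Here `hᵢ = 0` and both sides vanish, whatever `ψᵢ⁰` is.
    · simp [max_eq_left h1, max_eq_left h2]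
    · have h3 : ¬ D.ell i (-1) x z ≤ D.ell i 1 x z := by linarith
      simp [max_eq_left h1, max_eq_right h2.le, h2, h3]
  · have h2 : D.ell i (-1) x z < 0 := by linarith
    have h3 : D.ell i (-1) x z ≤ D.ell i 1 x z := by linarith
    simp [max_eq_left h2.le, h1, h1.le, h3]

/-! ### Directional derivatives -/

/-- The minus sign turns the largest active slope into a least value, which places these gradients
in the superdifferential. -/
lemma hasDerivWithinAt_neg_iSup (hD : D.Admissible) (i : Fin n) (j : Fin D.r) (ψ : ℝ) (x : E n)
    (d : E2 n) :
    ∃ a, IsLeast ((fun w => inner ℝ w d) '' D.superdiffNegMax i j x ψ) a ∧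
      HasDerivWithinAt (fun α : ℝ => -⨆ q, D.f i j q (x + α • d.fst) * ψ) a (Ioi 0) 0 := by
  have := Fin.pos_iff_nonempty.1 (hD.m_pos j)
  obtain ⟨a, ⟨⟨q₀, hq₀, hqa⟩, hub⟩, hda⟩ := hasDerivWithinAt_iSup fun q =>
    (hasDerivWithinAt_line (hD.contDiff_f i j q) x d.fst).mul_const ψ
  simp only [zero_smul, add_zero] at hq₀ hub
  have hin : ∀ q, inner ℝ (WithLp.toLp 2 (-(ψ • gradient (D.f i j q) x), (0 : E n))) d =
      -(inner ℝ (gradient (D.f i j q) x) d.fst * ψ) := fun q => by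
    rw [WithLp.prod_inner_apply]
    simp [inner_neg_left, real_inner_smul_left, mul_comm]
  refine ⟨-a, isLeast_inner_convexHull ⟨⟨q₀, hq₀, ?_⟩, ?_⟩, hda.neg⟩
  · rw [← hqa]
    exact hin q₀
  · rintro _ ⟨q, hq, rfl⟩
    dsimp only
    rw [hin]
    exact neg_le_neg (hub ⟨q, hq, rfl⟩)

lemma hasDerivWithinAt_neg_iInf (hD : D.Admissible) (i : Fin n) (j : Fin D.s) {ψ : ℝ}
    (hψ : ψ ∈ S1) (x : E n) (d : E2 n) :
    ∃ a, IsGreatest ((fun w => inner ℝ w d) '' D.subdiffNegMin i j x ψ) a ∧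
      HasDerivWithinAt (fun α : ℝ => -⨅ p, D.g i j p (x + α • d.fst) ψ) a (Ioi 0) 0 := by
  have := Fin.pos_iff_nonempty.1 (hD.k_pos j)
  obtain ⟨a, ⟨⟨q₀, hq₀, hqa⟩, hlb⟩, hda⟩ := hasDerivWithinAt_iInf fun p =>
    hasDerivWithinAt_line (hD.contDiff_g i j p ψ hψ) x d.fst
  simp only [zero_smul, add_zero] at hq₀ hlb
  have hin : ∀ p, inner ℝ
      (WithLp.toLp 2 (-gradient (fun y => D.g i j p y ψ) x, (0 : E n))) d =
      -(inner ℝ (gradient (fun y => D.g i j p y ψ) x) d.fst) := fun p => by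
    rw [WithLp.prod_inner_apply]
    simp [inner_neg_left]
  refine ⟨-a, isGreatest_inner_convexHull ⟨⟨q₀, hq₀, ?_⟩, ?_⟩, hda.neg⟩
  · rw [← hqa]
    exact hin q₀
  · rintro _ ⟨p, hp, rfl⟩
    dsimp only
    rw [hin]
    exact neg_le_neg (hlb ⟨p, hp, rfl⟩)

lemma hasDerivWithinAt_ell (hD : D.Admissible) (i : Fin n) {ψ : ℝ} (hψ : ψ ∈ S1) (y d : E2 n) :
    ∃ a b, IsGreatest ((fun w => inner ℝ w d) '' ∑ j, D.subdiffNegMin i j y.fst ψ) a ∧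
      IsLeast ((fun w => inner ℝ w d) ''
        ({WithLp.toLp 2 ((0 : E n), EuclideanSpace.single i ψ)} +
          ∑ j, D.superdiffNegMax i j y.fst ψ)) b ∧
      HasDerivWithinAt (fun α : ℝ => D.ell i ψ (y + α • d).fst (y + α • d).snd) (a + b)
        (Ioi 0) 0 := by
  choose a ha hda using fun j => hasDerivWithinAt_neg_iInf hD i j hψ y.fst d
  choose b hb hdb using fun j => hasDerivWithinAt_neg_iSup hD i j ψ y.fst d
  have hsingle : inner ℝ (WithLp.toLp 2 ((0 : E n), EuclideanSpace.single i ψ)) d =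
      d.snd i * ψ := by
    rw [WithLp.prod_inner_apply]
    simp [EuclideanSpace.inner_single_left, mul_comm]
  refine ⟨∑ j, a j, d.snd i * ψ + ∑ j, b j, isGreatest_inner_sum _ ha, ?_, ?_⟩
  · rw [← hsingle]
    exact isLeast_inner_add (isLeast_inner_singleton _ _) (isLeast_inner_sum _ hb)
  · have hlin : HasDerivWithinAt (fun α : ℝ => (y.snd i + α * d.snd i) * ψ) (d.snd i * ψ)
        (Ioi 0) 0 := by
      have := (((hasDerivAt_id (0 : ℝ)).mul_const (d.snd i)).const_add (y.snd i)).mul_const ψ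
      simpa using this.hasDerivWithinAt
    have hsum := (hlin.add (HasDerivWithinAt.fun_sum fun j (_ : j ∈ Finset.univ) => hdb j)).add
      (HasDerivWithinAt.fun_sum fun j (_ : j ∈ Finset.univ) => hda j)
    have heq : ∀ α : ℝ, D.ell i ψ (y + α • d).fst (y + α • d).snd =
        (y.snd i + α * d.snd i) * ψ + (∑ j, -⨆ q, D.f i j q (y.fst + α • d.fst) * ψ) +
          ∑ j, -⨅ p, D.g i j p (y.fst + α • d.fst) ψ := fun α => ell_eq hD i hψ _ _
    refine (hsum.congr (fun α _ => heq α) (heq 0)).congr_deriv ?_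
    ring

lemma hasDerivWithinAt_half_hi_sq (hD : D.Admissible) (hψ₀ : ∀ i, ψ₀ i ∈ S1) (i : Fin n)
    (y d : E2 n) :
    ∃ a b, IsGreatest ((fun w => inner ℝ w d) '' D.subdiffHalfSq ψ₀ i y.fst y.snd) a ∧
      IsLeast ((fun w => inner ℝ w d) '' D.superdiffHalfSq ψ₀ i y.fst y.snd) b ∧
      HasDerivWithinAt (fun α : ℝ => D.hi i (y + α • d).fst (y + α • d).snd ^ 2) (2 * (a + b))
        (Ioi 0) 0 := by
  -- The slopes are chosen as functions of all real `ψ`, with dummy value `0` off `S1`, so that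
  -- their sum can serve as the `L` of `posPart_ell_combination`.
  have hS : ∀ ψ : ℝ, ∃ a b, ψ ∈ S1 →
      IsGreatest ((fun w => inner ℝ w d) '' ∑ j, D.subdiffNegMin i j y.fst ψ) a ∧
      IsLeast ((fun w => inner ℝ w d) ''
        ({WithLp.toLp 2 ((0 : E n), EuclideanSpace.single i ψ)} +
          ∑ j, D.superdiffNegMax i j y.fst ψ)) b ∧
      HasDerivWithinAt (fun α : ℝ => D.ell i ψ (y + α • d).fst (y + α • d).snd) (a + b)
        (Ioi 0) 0 := fun ψ => by
    by_cases hψ : ψ ∈ S1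
    · obtain ⟨a, b, h⟩ := hasDerivWithinAt_ell hD i hψ y d
      exact ⟨a, b, fun _ => h⟩
    · exact ⟨0, 0, fun h => absurd h hψ⟩
  choose a b hab using hS
  have hstar := hab _ (psiStar_mem (D := D) hψ₀ i y.fst y.snd)
  have hnn := hi_nonneg (D := D) i y.fst y.snd
  refine ⟨_, _, isGreatest_inner_smul hnn hstar.1, isLeast_inner_smul hnn hstar.2.1, ?_⟩
  have hsq : ∀ ψ ∈ S1, HasDerivWithinAt
      (fun α : ℝ => max 0 (D.ell i ψ (y + α • d).fst (y + α • d).snd) ^ 2)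
      (2 * max 0 (D.ell i ψ y.fst y.snd) * (a ψ + b ψ)) (Ioi 0) 0 := fun ψ hψ => by
    have h1 : HasDerivAt (fun s : ℝ => max 0 s ^ 2) (2 * max 0 (D.ell i ψ y.fst y.snd))
        (D.ell i ψ (y + (0 : ℝ) • d).fst (y + (0 : ℝ) • d).snd) := by
      rw [zero_smul, add_zero]
      exact hasDerivAt_posPart_sq _
    exact h1.comp_hasDerivWithinAt 0 (hab ψ hψ).2.2
  have h1 : (1 : ℝ) ∈ S1 := by simp [S1_eq]
  have h2 : (-1 : ℝ) ∈ S1 := by simp [S1_eq]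
  refine (((hsq 1 h1).add (hsq (-1) h2)).congr (fun α _ => hi_sq hD i _ _)
    (hi_sq hD i _ _)).congr_deriv ?_
  have := posPart_ell_combination (ψ₀ := ψ₀) hD i y.fst y.snd fun ψ => a ψ + b ψ
  linear_combination 2 * this

lemma tendsto_norm_h_sq (hD : D.Admissible) (hψ₀ : ∀ i, ψ₀ i ∈ S1) (y d : E2 n) :
    ∃ a b, IsGreatest ((fun w => inner ℝ w d) '' ∑ i, D.subdiffHalfSq ψ₀ i y.fst y.snd) a ∧
      IsLeast ((fun w => inner ℝ w d) '' ∑ i, D.superdiffHalfSq ψ₀ i y.fst y.snd) b ∧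
      Tendsto (fun α : ℝ => α⁻¹ * (‖D.h (y + α • d).fst (y + α • d).snd‖ ^ 2 -
        ‖D.h y.fst y.snd‖ ^ 2)) (𝓝[>] 0) (𝓝 (2 * (a + b))) := by
  choose a b ha hb hd using fun i => hasDerivWithinAt_half_hi_sq hD hψ₀ i y d
  refine ⟨∑ i, a i, ∑ i, b i, isGreatest_inner_sum _ ha, isLeast_inner_sum _ hb, ?_⟩
  have hsum := HasDerivWithinAt.fun_sum fun i (_ : i ∈ Finset.univ) => hd i
  rw [← Finset.mul_sum, Finset.sum_add_distrib,
    hasDerivWithinAt_iff_tendsto_slope' (notMem_Ioi.2 le_rfl)] at hsum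
  simpa [slope_fun_def, norm_h_sq] using hsum

lemma isQuasidifferentialAt_norm_h_sq (hD : D.Admissible) (hψ₀ : ∀ i, ψ₀ i ∈ S1) (x z : E n) :
    IsQuasidifferentialAt (fun y : E2 n => ‖D.h y.fst y.snd‖ ^ 2) (WithLp.toLp 2 (x, z))
      (D.subdiffSq ψ₀ x z) (D.superdiffSq ψ₀ x z) := by
  have hA := (IsConvexBody.sum Finset.univ fun i =>
    isConvexBody_subdiffHalfSq (ψ₀ := ψ₀) hD i x z).smul 2
  have hB := (IsConvexBody.sum Finset.univ fun i =>
    isConvexBody_superdiffHalfSq (ψ₀ := ψ₀) hD i x z).smul 2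
  refine ⟨hA.1, hA.2.1, hB.1, hB.2.1, fun d => ?_⟩
  obtain ⟨a, b, ha, hb, h⟩ := tendsto_norm_h_sq hD hψ₀ (WithLp.toLp 2 (x, z)) d
  refine ⟨2 * a, 2 * b, isGreatest_inner_smul zero_le_two ha, isLeast_inner_smul zero_le_two hb, ?_⟩
  rw [← mul_add]
  exact h

/-! ### Regularity of `h` -/

lemma locallyLipschitz_ell (hD : D.Admissible) (i : Fin n) {ψ : ℝ} (hψ : ψ ∈ S1) :
    LocallyLipschitz fun y : E2 n => D.ell i ψ y.fst y.snd := by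
  have hfst : ContDiff ℝ 1 fun y : E2 n => y.fst := (WithLp.fstL 2 ℝ (E n) (E n)).contDiff
  have hlin : ContDiff ℝ 1 fun y : E2 n => y.snd i * ψ :=
    ((EuclideanSpace.proj (𝕜 := ℝ) i).comp (WithLp.sndL 2 ℝ (E n) (E n))).contDiff.mul
      contDiff_const
  simp only [ell_eq hD i hψ]
  refine (hlin.locallyLipschitz.add (locallyLipschitz_sum _ fun j => ?_)).add
    (locallyLipschitz_sum _ fun j => ?_)
  · have := Fin.pos_iff_nonempty.1 (hD.m_pos j)
    exact (locallyLipschitz_iSup fun q =>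
      (((hD.contDiff_f i j q).comp hfst).mul contDiff_const).locallyLipschitz).neg
  · have := Fin.pos_iff_nonempty.1 (hD.k_pos j)
    exact (locallyLipschitz_iInf fun p =>
      ((hD.contDiff_g i j p ψ hψ).comp hfst).locallyLipschitz).neg

lemma locallyLipschitz_hi (hD : D.Admissible) (i : Fin n) :
    LocallyLipschitz fun y : E2 n => D.hi i y.fst y.snd := by
  simp only [hi_eq]
  exact ((locallyLipschitz_ell hD i (by simp [S1_eq])).const_max 0).max
    ((locallyLipschitz_ell hD i (by simp [S1_eq])).const_max 0)

/-- Serves twice: continuity gives integrability along curves, and the Lipschitz constant on a ball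
gives the dominating function for `φ`. -/
lemma locallyLipschitz_norm_h_sq (hD : D.Admissible) :
    LocallyLipschitz fun y : E2 n => ‖D.h y.fst y.snd‖ ^ 2 := by
  simp only [norm_h_sq]
  exact locallyLipschitz_sum _ fun i =>
    (contDiff_id.pow 2 : ContDiff ℝ 1 fun s : ℝ => s ^ 2).locallyLipschitz.comp
      (locallyLipschitz_hi hD i)

end Inclusion

/-! ### Curves in `ℝⁿ × ℝⁿ` and extremal values over integral functionals -/

section Curves

variable {T : ℝ} {n : ℕ}

/-- The curve `t ↦ (x(t), z(t))` in `ℝⁿ × ℝⁿ`. -/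
def X.curve (p : X T n) (t : Icc (0 : ℝ) T) : E2 n := WithLp.toLp 2 (p.x t, p.z t)

lemma X.continuous_x (p : X T n) : Continuous p.x := p.1.continuous

lemma X.measurable_z (p : X T n) : Measurable p.z := by
  obtain ⟨⟨S, hS, hc⟩, -⟩ := p.2.2
  have hcount : Countable S := hS.countable.to_subtype
  refine measurable_of_restrict_of_restrict_compl hS.measurableSet
    (measurable_of_countable _) ?_
  have hcont : ContinuousOn p.z Sᶜ := fun t ht => (hc t ht).continuousWithinAt
  exact (continuousOn_iff_continuous_domRestrict.1 hcont).measurable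

lemma X.stronglyMeasurable_curve (p : X T n) : StronglyMeasurable p.curve :=
  (WithLp.prod_continuous_toLp 2 (E n) (E n)).comp_stronglyMeasurable
    (p.continuous_x.stronglyMeasurable.prodMk p.measurable_z.stronglyMeasurable)

lemma X.exists_norm_curve_le (p : X T n) : ∃ C, 0 ≤ C ∧ ∀ t, ‖p.curve t‖ ≤ C := by
  obtain ⟨-, C, hC⟩ := p.2.2
  refine ⟨‖p.1‖ + |C|, by positivity, fun t => ?_⟩
  rw [WithLp.prod_norm_eq_of_L2]
  have h1 : ‖p.x t‖ ≤ ‖p.1‖ := p.1.norm_coe_le_norm t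
  have h2 : ‖p.z t‖ ≤ |C| := (hC t).trans (le_abs_self C)
  refine Real.sqrt_le_iff.2 ⟨by positivity, ?_⟩
  change ‖p.x t‖ ^ 2 + ‖p.z t‖ ^ 2 ≤ _
  nlinarith [norm_nonneg (p.x t), norm_nonneg (p.z t)]

lemma integrable_inner_of_memLp_top {v w : Icc (0 : ℝ) T → E n} (hv : MemLp v ∞ (leb T))
    (hw : MemLp w 2 (leb T)) : Integrable (fun t => inner ℝ (v t) (w t)) (leb T) :=
  ((hv.mono_exponent le_top : MemLp v 2 (leb T)).norm.integrable_mul hw.norm).mono'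
    (hv.1.inner hw.1) (Eventually.of_forall fun t => by
      simpa using norm_inner_le_norm (𝕜 := ℝ) (v t) (w t))

lemma integral_inner_curve {v₁ v₂ : Icc (0 : ℝ) T → E n} (h₁ : MemLp v₁ ∞ (leb T))
    (h₂ : MemLp v₂ ∞ (leb T)) (g : X T n) :
    Integrable (fun t => inner ℝ (WithLp.toLp 2 (v₁ t, v₂ t)) (g.curve t)) (leb T) ∧
      (∫ t, inner ℝ (v₁ t) (g.x t) ∂leb T) + ∫ t, inner ℝ (v₂ t) (g.z t) ∂leb T =
        ∫ t, inner ℝ (WithLp.toLp 2 (v₁ t, v₂ t)) (g.curve t) ∂leb T := by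
  have i₁ := integrable_inner_of_memLp_top h₁ (memLp_continuous g.1)
  have i₂ := integrable_inner_of_memLp_top h₂ (memLp_piecewise g.2)
  have he : (fun t => inner ℝ (WithLp.toLp 2 (v₁ t, v₂ t)) (g.curve t)) =
      fun t => inner ℝ (v₁ t) (g.1 t) + inner ℝ (v₂ t) (g.2.1 t) := by
    ext t
    rw [WithLp.prod_inner_apply]
    rfl
  rw [he, integral_add i₁ i₂]
  exact ⟨i₁.add i₂, rfl⟩

/-- Interchange of maximum and integral: a measurable selection of pointwise maximizers is bounded,
hence defines an admissible functional attaining `∫ a`, and no other selection can exceed `a`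
pointwise. -/
lemma isGreatest_integralFunctionals {K : Icc (0 : ℝ) T → Set (E2 n)} {g : X T n}
    (hb : UniformlyBounded K) (hs : HasMaxSelection K g.curve) {a : Icc (0 : ℝ) T → ℝ}
    (ha : ∀ t, IsGreatest ((fun v => inner ℝ v (g.curve t)) '' K t) (a t)) :
    Integrable a (leb T) ∧
      IsGreatest ((fun v : WeakDual ℝ (X T n) => v g) '' integralFunctionals K)
        (∫ t, a t ∂leb T) := by
  obtain ⟨R, -, hR⟩ := hb
  obtain ⟨v, hv, hvK⟩ := hs
  have h₁ : MemLp (fun t => (v t).fst) ∞ (leb T) :=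
    MemLp.of_bound (((WithLp.fstL 2 ℝ (E n) (E n)).continuous.comp_stronglyMeasurable
      hv).aestronglyMeasurable) R
      (Eventually.of_forall fun t => (WithLp.norm_fst_le (x := v t)).trans (hR t _ (hvK t).1))
  have h₂ : MemLp (fun t => (v t).snd) ∞ (leb T) :=
    MemLp.of_bound (((WithLp.sndL 2 ℝ (E n) (E n)).continuous.comp_stronglyMeasurable
      hv).aestronglyMeasurable) R
      (Eventually.of_forall fun t => (WithLp.norm_snd_le (x := v t)).trans (hR t _ (hvK t).1))
  -- The pointwise maximum is unique, so `a` inherits its measurability from the selection.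
  have hav : a = fun t => inner ℝ (v t) (g.curve t) := by
    ext t
    refine le_antisymm ?_ ((ha t).2 (mem_image_of_mem _ (hvK t).1))
    obtain ⟨w, hw, hwa⟩ := (ha t).1
    rw [← hwa]
    exact (hvK t).2 w hw
  obtain ⟨hint, hval⟩ := integral_inner_curve h₁ h₂ g
  have hint' : Integrable a (leb T) := hav ▸ hint
  refine ⟨hint', ?_, ?_⟩
  · have hφ := l2Functional_toLp (h₁.mono_exponent le_top) (h₂.mono_exponent le_top)
    refine ⟨_, ⟨_, _, h₁, h₂, fun t => (hvK t).1, hφ⟩, ?_⟩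
    dsimp only
    rw [hφ, hval, hav]
    rfl
  · rintro _ ⟨φ, ⟨w₁, w₂, hw₁, hw₂, hw, hφ⟩, rfl⟩
    obtain ⟨hint2, hval2⟩ := integral_inner_curve hw₁ hw₂ g
    dsimp only
    rw [hφ, hval2]
    exact integral_mono hint2 hint' fun t => (ha t).2 (mem_image_of_mem _ (hw t))

lemma X.curve_neg (g : X T n) (t : Icc (0 : ℝ) T) : (-g).curve t = -g.curve t := rfl

lemma isLeast_integralFunctionals {K : Icc (0 : ℝ) T → Set (E2 n)} {g : X T n}
    (hb : UniformlyBounded K) (hs : HasMaxSelection K (-g).curve) {b : Icc (0 : ℝ) T → ℝ}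
    (hmin : ∀ t, IsLeast ((fun v => inner ℝ v (g.curve t)) '' K t) (b t)) :
    Integrable b (leb T) ∧
      IsLeast ((fun v : WeakDual ℝ (X T n) => v g) '' integralFunctionals K)
        (∫ t, b t ∂leb T) := by
  obtain ⟨hint, ⟨φ, hφ, hφv⟩, hub⟩ := isGreatest_integralFunctionals (a := fun t => -b t) hb hs
    fun t => by simpa only [X.curve_neg] using isLeast_inner_iff.1 (hmin t)
  rw [integral_neg] at hφv hub
  refine ⟨hint.neg.congr (Eventually.of_forall fun t => neg_neg (b t)), ⟨φ, hφ, ?_⟩, ?_⟩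
  · dsimp only at hφv ⊢
    rw [map_neg] at hφv
    linarith
  · rintro _ ⟨φ', hφ', rfl⟩
    have := hub (mem_image_of_mem _ hφ')
    dsimp only at this ⊢
    rw [map_neg] at this
    linarith

end Curves

/-! ### Measurability, bounds and the derivative of `φ` along a curve -/

namespace Inclusion

variable {n : ℕ} {D : Inclusion n} {ψ₀ : Fin n → ℝ} {T : ℝ}

lemma exists_abs_le_along_curve {F : E2 n → ℝ} (hF : Continuous F) (p : X T n) :
    ∃ C, ∀ t, |F (p.curve t)| ≤ C := by
  obtain ⟨R, -, hR⟩ := p.exists_norm_curve_le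
  obtain ⟨C, hC⟩ := (isCompact_closedBall (0 : E2 n) R).exists_bound_of_continuousOn hF.continuousOn
  exact ⟨C, fun t => hC _ (mem_closedBall_zero_iff.2 (hR t))⟩

lemma exists_norm_le_of_continuous {H : Type*} [NormedAddCommGroup H] {w : Icc (0 : ℝ) T → H}
    (hw : Continuous w) : ∃ C, ∀ t, ‖w t‖ ≤ C := by
  obtain ⟨C, hC⟩ := isCompact_univ.exists_bound_of_continuousOn hw.continuousOn
  exact ⟨C, fun t => hC t (mem_univ t)⟩

lemma continuous_gradient_f (hD : D.Admissible) (p : X T n) (i : Fin n) (j : Fin D.r)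
    (q : Fin (D.m j)) (ψ : ℝ) : Continuous fun t =>
      (WithLp.toLp 2 (-(ψ • gradient (D.f i j q) (p.x t)), (0 : E n)) : E2 n) := by
  have := (gradient_continuous (hD.contDiff_f i j q)).comp p.continuous_x
  exact (WithLp.prod_continuous_toLp 2 (E n) (E n)).comp
    ((this.const_smul ψ).neg.prodMk continuous_const)

lemma continuous_gradient_g (hD : D.Admissible) (p : X T n) (i : Fin n) (j : Fin D.s)
    (q : Fin (D.k j)) {ψ : ℝ} (hψ : ψ ∈ S1) : Continuous fun t =>
      (WithLp.toLp 2 (-gradient (fun y => D.g i j q y ψ) (p.x t), (0 : E n)) : E2 n) := by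
  have := (gradient_continuous (hD.contDiff_g i j q ψ hψ)).comp p.continuous_x
  exact (WithLp.prod_continuous_toLp 2 (E n) (E n)).comp (this.neg.prodMk continuous_const)

/-- Activity depends on `x(t)` alone and is an equality of two continuous functions of `t`, so it
holds on a closed set. -/
lemma measurableSet_R1 (hD : D.Admissible) (p : X T n) (i : Fin n) (j : Fin D.r)
    (q : Fin (D.m j)) (ψ : ℝ) : MeasurableSet {t | q ∈ D.R1 i j (p.x t) ψ} := by
  have := Fin.pos_iff_nonempty.1 (hD.m_pos j)
  have hc : ∀ q, ContDiff ℝ 1 fun x => D.f i j q x * ψ := fun q =>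
    (hD.contDiff_f i j q).mul contDiff_const
  exact (isClosed_eq ((hc q).continuous.comp p.continuous_x)
    ((locallyLipschitz_iSup fun q => (hc q).locallyLipschitz).continuous.comp
      p.continuous_x)).measurableSet

lemma measurableSet_R2 (hD : D.Admissible) (p : X T n) (i : Fin n) (j : Fin D.s)
    (q : Fin (D.k j)) {ψ : ℝ} (hψ : ψ ∈ S1) : MeasurableSet {t | q ∈ D.R2 i j (p.x t) ψ} := by
  have := Fin.pos_iff_nonempty.1 (hD.k_pos j)
  have hc : ∀ q, ContDiff ℝ 1 fun x => D.g i j q x ψ := fun q => hD.contDiff_g i j q ψ hψ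
  exact (isClosed_eq ((hc q).continuous.comp p.continuous_x)
    ((locallyLipschitz_iInf fun q => (hc q).locallyLipschitz).continuous.comp
      p.continuous_x)).measurableSet

lemma stronglyMeasurable_hi (hD : D.Admissible) (p : X T n) (i : Fin n) :
    StronglyMeasurable fun t => D.hi i (p.x t) (p.z t) :=
  (locallyLipschitz_hi hD i).continuous.comp_stronglyMeasurable p.stronglyMeasurable_curve

lemma stronglyMeasurable_ell (hD : D.Admissible) (p : X T n) (i : Fin n) {ψ : ℝ} (hψ : ψ ∈ S1) :
    StronglyMeasurable fun t => D.ell i ψ (p.x t) (p.z t) :=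
  (locallyLipschitz_ell hD i hψ).continuous.comp_stronglyMeasurable p.stronglyMeasurable_curve

lemma measurableSet_psiStar_eq (hD : D.Admissible) (p : X T n) (i : Fin n) (ψ : ℝ) :
    MeasurableSet {t | D.psiStar ψ₀ i (p.x t) (p.z t) = ψ} := by
  have hm : Measurable fun t => D.psiStar ψ₀ i (p.x t) (p.z t) :=
    Measurable.ite (measurableSet_lt measurable_const (stronglyMeasurable_hi hD p i).measurable)
      (Measurable.ite (measurableSet_le (stronglyMeasurable_ell hD p i (by simp [S1_eq])).measurable
        (stronglyMeasurable_ell hD p i (by simp [S1_eq])).measurable)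
        measurable_const measurable_const) measurable_const
  exact hm (measurableSet_singleton ψ)

lemma psiStar_eq_neg_one (hψ₀ : ∀ i, ψ₀ i ∈ S1) {i : Fin n} {x z : E n}
    (h : D.psiStar ψ₀ i x z ≠ 1) : D.psiStar ψ₀ i x z = -1 := by
  have := psiStar_mem (D := D) hψ₀ i x z
  rw [S1_eq] at this
  exact this.resolve_left h

/-- `ψᵢ*` takes only the values `±1`, each on a measurable set of instants, so selections for fixed
`ψ` can be glued; the factor `hᵢ ≥ 0` preserves maximizers. -/
lemma hasMaxSelection_of_psiStar (hD : D.Admissible) (hψ₀ : ∀ i, ψ₀ i ∈ S1) (p : X T n)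
    (i : Fin n) {d : Icc (0 : ℝ) T → E2 n} {L : ℝ → Icc (0 : ℝ) T → Set (E2 n)}
    (hL : ∀ ψ ∈ S1, HasMaxSelection (L ψ) d) :
    HasMaxSelection (fun t => D.hi i (p.x t) (p.z t) • L (D.psiStar ψ₀ i (p.x t) (p.z t)) t) d := by
  refine HasMaxSelection.smul ?_ (stronglyMeasurable_hi hD p i) fun t => hi_nonneg i _ _
  exact (hL 1 (by simp [S1_eq])).of_cases (hL (-1) (by simp [S1_eq]))
    (measurableSet_psiStar_eq (ψ₀ := ψ₀) hD p i 1) (fun t h => by rw [h])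
    (fun t h => by rw [psiStar_eq_neg_one hψ₀ h])

lemma uniformlyBounded_of_psiStar (hD : D.Admissible) (hψ₀ : ∀ i, ψ₀ i ∈ S1) (p : X T n)
    (i : Fin n) {L : ℝ → Icc (0 : ℝ) T → Set (E2 n)} (hL : ∀ ψ ∈ S1, UniformlyBounded (L ψ)) :
    UniformlyBounded
      (fun t => D.hi i (p.x t) (p.z t) • L (D.psiStar ψ₀ i (p.x t) (p.z t)) t) := by
  obtain ⟨C, hC⟩ := exists_abs_le_along_curve (locallyLipschitz_hi hD i).continuous p
  refine UniformlyBounded.smul ?_ hC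
  obtain ⟨R₁, h₁, hR₁⟩ := hL 1 (by simp [S1_eq])
  obtain ⟨R₂, h₂, hR₂⟩ := hL (-1) (by simp [S1_eq])
  refine ⟨max R₁ R₂, le_max_of_le_left h₁, fun t v hv => ?_⟩
  by_cases h : D.psiStar ψ₀ i (p.x t) (p.z t) = 1
  · simp only [h] at hv
    exact (hR₁ t v hv).trans (le_max_left _ _)
  · simp only [psiStar_eq_neg_one hψ₀ h] at hv
    exact (hR₂ t v hv).trans (le_max_right _ _)

lemma hasMaxSelection_sum_superdiffHalfSq (hD : D.Admissible) (hψ₀ : ∀ i, ψ₀ i ∈ S1) (p : X T n)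
    {d : Icc (0 : ℝ) T → E2 n} (hd : StronglyMeasurable d) :
    HasMaxSelection (fun t => ∑ i, D.superdiffHalfSq ψ₀ i (p.x t) (p.z t)) d :=
  HasMaxSelection.sum _ fun i => hasMaxSelection_of_psiStar hD hψ₀ p i
    (L := fun ψ t => {WithLp.toLp 2 ((0 : E n), EuclideanSpace.single i ψ)} +
      ∑ j, D.superdiffNegMax i j (p.x t) ψ) fun ψ _ =>
    (hasMaxSelection_singleton stronglyMeasurable_const d).add (HasMaxSelection.sum _ fun j =>
      hasMaxSelection_convexHull
        (fun q => (continuous_gradient_f hD p i j q ψ).stronglyMeasurable) hd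
        (fun q => measurableSet_R1 hD p i j q ψ) fun t => R1_nonempty hD i j (p.x t) ψ)

lemma hasMaxSelection_sum_subdiffHalfSq (hD : D.Admissible) (hψ₀ : ∀ i, ψ₀ i ∈ S1) (p : X T n)
    {d : Icc (0 : ℝ) T → E2 n} (hd : StronglyMeasurable d) :
    HasMaxSelection (fun t => ∑ i, D.subdiffHalfSq ψ₀ i (p.x t) (p.z t)) d :=
  HasMaxSelection.sum _ fun i => hasMaxSelection_of_psiStar hD hψ₀ p i
    (L := fun ψ t => ∑ j, D.subdiffNegMin i j (p.x t) ψ) fun ψ hψ =>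
    HasMaxSelection.sum _ fun j => hasMaxSelection_convexHull
      (fun q => (continuous_gradient_g hD p i j q hψ).stronglyMeasurable) hd
      (fun q => measurableSet_R2 hD p i j q hψ) fun t => R2_nonempty hD i j (p.x t) ψ

lemma uniformlyBounded_sum_superdiffHalfSq (hD : D.Admissible) (hψ₀ : ∀ i, ψ₀ i ∈ S1)
    (p : X T n) : UniformlyBounded fun t => ∑ i, D.superdiffHalfSq ψ₀ i (p.x t) (p.z t) :=
  UniformlyBounded.sum _ fun i => uniformlyBounded_of_psiStar hD hψ₀ p i
    (L := fun ψ t => {WithLp.toLp 2 ((0 : E n), EuclideanSpace.single i ψ)} +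
      ∑ j, D.superdiffNegMax i j (p.x t) ψ) fun ψ _ =>
    UniformlyBounded.add ⟨_, norm_nonneg _, fun _ _ hv => (congrArg norm hv).le⟩
      (UniformlyBounded.sum _ fun j => UniformlyBounded.convexHull_image fun q =>
        exists_norm_le_of_continuous (continuous_gradient_f hD p i j q ψ))

lemma uniformlyBounded_sum_subdiffHalfSq (hD : D.Admissible) (hψ₀ : ∀ i, ψ₀ i ∈ S1)
    (p : X T n) : UniformlyBounded fun t => ∑ i, D.subdiffHalfSq ψ₀ i (p.x t) (p.z t) :=
  UniformlyBounded.sum _ fun i => uniformlyBounded_of_psiStar hD hψ₀ p i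
    (L := fun ψ t => ∑ j, D.subdiffNegMin i j (p.x t) ψ) fun _ hψ =>
    UniformlyBounded.sum _ fun j => UniformlyBounded.convexHull_image fun q =>
      exists_norm_le_of_continuous (continuous_gradient_g hD p i j q hψ)

lemma integrable_norm_h_sq (hD : D.Admissible) (p : X T n) :
    Integrable (fun t => ‖D.h (p.x t) (p.z t)‖ ^ 2) (leb T) := by
  have hc := (locallyLipschitz_norm_h_sq hD).continuous
  obtain ⟨C, hC⟩ := exists_abs_le_along_curve hc p
  exact Integrable.of_bound
    (hc.comp_stronglyMeasurable p.stronglyMeasurable_curve).aestronglyMeasurable C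
    (Eventually.of_forall hC)

/-- Differentiation of `φ` under the integral sign. -/
lemma tendsto_phi (hD : D.Admissible) (p g : X T n) {c : Icc (0 : ℝ) T → ℝ}
    (hc : ∀ t, Tendsto (fun α : ℝ => α⁻¹ *
      (‖D.h (p.curve t + α • g.curve t).fst (p.curve t + α • g.curve t).snd‖ ^ 2 -
        ‖D.h (p.curve t).fst (p.curve t).snd‖ ^ 2)) (𝓝[>] 0) (𝓝 (2 * c t))) :
    Tendsto (fun α : ℝ => α⁻¹ * (D.phi (p + α • g) - D.phi p)) (𝓝[>] 0)
      (𝓝 (∫ t, c t ∂leb T)) := by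
  obtain ⟨R₁, hR₁, hp⟩ := p.exists_norm_curve_le
  obtain ⟨R₂, hR₂, hg⟩ := g.exists_norm_curve_le
  -- The ball of radius `R₁ + R₂` contains both curves `p` and `p + α g` for `0 < α < 1`. There
  -- `‖h‖²` changes by at most `L α R₂`, so the quotients are dominated by `L R₂`.
  obtain ⟨L, hL⟩ := (locallyLipschitz_norm_h_sq hD).locallyLipschitzOn
    |>.exists_lipschitzOnWith_of_compact (isCompact_closedBall (0 : E2 n) (R₁ + R₂))
  have hlim := tendsto_integral_filter_of_dominated_convergence (μ := leb T) (l := 𝓝[>] (0 : ℝ))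
    (F := fun α t => α⁻¹ *
      (‖D.h (p.curve t + α • g.curve t).fst (p.curve t + α • g.curve t).snd‖ ^ 2 -
        ‖D.h (p.curve t).fst (p.curve t).snd‖ ^ 2))
    (fun _ => L * R₂) ?_ ?_ (integrable_const _) (Eventually.of_forall hc)
  · rw [integral_const_mul] at hlim
    -- The factor `1/2` in `φ` cancels the `2` produced by differentiating a square.
    have := hlim.const_mul (1 / 2)
    rw [← mul_assoc, one_div_mul_cancel two_ne_zero, one_mul] at this
    refine this.congr fun α => ?_
    rw [integral_const_mul]
    have hsub := integral_sub (integrable_norm_h_sq hD (p + α • g)) (integrable_norm_h_sq hD p)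
    rw [phi, phi, ← mul_sub, ← hsub, mul_left_comm]
    rfl
  · refine Eventually.of_forall fun α => ?_
    exact (((integrable_norm_h_sq hD (p + α • g)).1.sub (integrable_norm_h_sq hD p).1).const_mul
      α⁻¹)
  · filter_upwards [Ioo_mem_nhdsGT (zero_lt_one (α := ℝ))] with α hα
    refine Eventually.of_forall fun t => ?_
    have hs : ‖α • g.curve t‖ ≤ α * R₂ := by
      rw [norm_smul, Real.norm_of_nonneg hα.1.le]
      exact mul_le_mul_of_nonneg_left (hg t) hα.1.le
    have h1 : p.curve t ∈ Metric.closedBall (0 : E2 n) (R₁ + R₂) :=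
      mem_closedBall_zero_iff.2 ((hp t).trans (le_add_of_nonneg_right hR₂))
    have h2 : p.curve t + α • g.curve t ∈ Metric.closedBall (0 : E2 n) (R₁ + R₂) := by
      refine mem_closedBall_zero_iff.2 ((norm_add_le _ _).trans (add_le_add (hp t) (hs.trans ?_)))
      exact mul_le_of_le_one_left hR₂ hα.2.le
    have h3 := hL.dist_le_mul _ h2 _ h1
    rw [dist_eq_norm, dist_eq_norm, add_sub_cancel_left] at h3
    rw [norm_mul, norm_inv, Real.norm_of_nonneg hα.1.le, inv_mul_le_iff₀ hα.1]
    refine h3.trans ((mul_le_mul_of_nonneg_left hs L.2).trans_eq ?_)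
    change (L : ℝ) * (α * R₂) = _
    ring

lemma half_smul_two_smul {H : Type*} [AddCommGroup H] [Module ℝ H] (A : Set H) :
    (1 / 2 : ℝ) • ((2 : ℝ) • A) = A := by
  rw [smul_smul]
  norm_num

/-- `φ` is quasidifferentiable, with quasidifferential given by the measurable selections of the
quasidifferentials of `½ h²`. -/
lemma isFunctionalQuasidifferentialAt_phi (hD : D.Admissible) (hψ₀ : ∀ i, ψ₀ i ∈ S1)
    (p : X T n) :
    IsFunctionalQuasidifferentialAt D.phi p
      (integralFunctionals fun t => (1 / 2 : ℝ) • D.subdiffSq ψ₀ (p.x t) (p.z t))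
      (integralFunctionals fun t => (1 / 2 : ℝ) • D.superdiffSq ψ₀ (p.x t) (p.z t)) := by
  simp only [subdiffSq, superdiffSq, half_smul_two_smul]
  have hA : ∀ t, IsConvexBody (∑ i, D.subdiffHalfSq ψ₀ i (p.x t) (p.z t)) := fun t =>
    IsConvexBody.sum _ fun i => isConvexBody_subdiffHalfSq hD i _ _
  have hB : ∀ t, IsConvexBody (∑ i, D.superdiffHalfSq ψ₀ i (p.x t) (p.z t)) := fun t =>
    IsConvexBody.sum _ fun i => isConvexBody_superdiffHalfSq hD i _ _
  have hbA := uniformlyBounded_sum_subdiffHalfSq hD hψ₀ p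
  have hbB := uniformlyBounded_sum_superdiffHalfSq hD hψ₀ p
  obtain ⟨RA, hRA, hKA⟩ := id hbA
  obtain ⟨RB, hRB, hKB⟩ := id hbB
  refine ⟨convex_integralFunctionals (fun t => (hA t).2.2) (fun t => (hA t).1) hKA,
    isCompact_integralFunctionals hRA (fun t => (hA t).2.2) (fun t => (hA t).1)
      (fun t => (hA t).2.1.isClosed) hKA,
    convex_integralFunctionals (fun t => (hB t).2.2) (fun t => (hB t).1) hKB,
    isCompact_integralFunctionals hRB (fun t => (hB t).2.2) (fun t => (hB t).1)
      (fun t => (hB t).2.1.isClosed) hKB, fun g => ?_⟩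
  choose a b ha hb hlim using fun t => tendsto_norm_h_sq hD hψ₀ (p.curve t) (g.curve t)
  obtain ⟨hia, hga⟩ := isGreatest_integralFunctionals hbA
    (hasMaxSelection_sum_subdiffHalfSq hD hψ₀ p g.stronglyMeasurable_curve) ha
  obtain ⟨hib, hgb⟩ := isLeast_integralFunctionals hbB
    (hasMaxSelection_sum_superdiffHalfSq hD hψ₀ p (-g).stronglyMeasurable_curve) hb
  refine ⟨_, _, hga, hgb, ?_⟩
  rw [← integral_add hia hib]
  exact tendsto_phi hD p g hlim

end Inclusion

end QuasiInclusion

end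

theorem mainTheorem1 {n : ℕ} {T : ℝ} (hT : 0 < T)
    (D : QuasiInclusion.Inclusion n) (hD : D.Admissible)
    (ψ₀ : Fin n → ℝ) (hψ₀ : ∀ i, ψ₀ i ∈ QuasiInclusion.S1) :
    (∀ x z : QuasiInclusion.E n,
      QuasiInclusion.IsQuasidifferentialAt
        (fun y : QuasiInclusion.E2 n => ‖D.h y.fst y.snd‖ ^ 2) (WithLp.toLp 2 (x, z))
        (D.subdiffSq ψ₀ x z) (D.superdiffSq ψ₀ x z)) ∧
    (∀ p : QuasiInclusion.X T n,
      Integrable (fun t => ‖D.h (p.x t) (p.z t)‖ ^ 2) (QuasiInclusion.leb T)) ∧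
    ∀ p : QuasiInclusion.X T n, D.PiecewiseActive ψ₀ p →
      QuasiInclusion.IsFunctionalQuasidifferentialAt D.phi p
        (QuasiInclusion.integralFunctionals
          fun t => (1 / 2 : ℝ) • D.subdiffSq ψ₀ (p.x t) (p.z t))
        (QuasiInclusion.integralFunctionals
          fun t => (1 / 2 : ℝ) • D.superdiffSq ψ₀ (p.x t) (p.z t)) :=
  ⟨QuasiInclusion.Inclusion.isQuasidifferentialAt_norm_h_sq hD hψ₀,
    QuasiInclusion.Inclusion.integrable_norm_h_sq hD,
    fun p _ => QuasiInclusion.Inclusion.isFunctionalQuasidifferentialAt_phi hD hψ₀ p⟩
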